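/- Let $m\ge 1$ be an integer and let $x$ be a complex random variable with $\mathbb E x=0$, $\mathbb E|x|^2=1$ and $\mathbb E|x|^4<\infty$. For every $N\ge 1$ let $x_{ij}=x_{ij}^{(N)}$, $1\le i,j\le N$, be independent copies of $x$ (for different $N$ these arrays may be related in any way; for instance, they may all be cut out of one infinite array). Put $\mathbf X=(N^{-1/2}x_{ij})_{1\le i,j\le N}$, let $\lambda_1,\dots,\lambda_N$ be the eigenvalues, with multiplicity, of $\mathbf X^m(\mathbf X^*)^m$ (the squared singular values of $\mathbf X^m$), and let $$F_N^{(m)}(t)=\frac1N\sum_{k=1}^N \mathbb I\{\lambda_k\le t\},\qquad t\in\mathbb R .$$ There is exactly one probability measure on $\mathbb R$ all of whose moments are finite and given by the Fuss--Catalan numbers $$\int_{\mathbb R} s^p\,dG^{(m)}(s)=\frac1{mp+1}\binom{mp+p}{p},\qquad p=0,1,2,\dots;$$ let $G^{(m)}$ denote this measure and also its distribution function. Then for every $t\in\mathbb R$ the limit $\lim_{N\to\infty}\mathbb E F_N^{(m)}(t)$ exists and equals $G^{(m)}(t)$. -/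

import Mathlib

open MeasureTheory ProbabilityTheory Filter Topology
open scoped Matrix

noncomputable section

/-- The random matrix with entries `N^{-1/2} x_{ij}`, at one sample point. -/
def scaledMatrix {N : ℕ} (x : Fin N → Fin N → ℂ) : Matrix (Fin N) (Fin N) ℂ :=
  Matrix.of fun i j => ((Real.sqrt N : ℝ) : ℂ)⁻¹ * x i j

/-- The matrix `W = X^m (X^*)^m`. -/
def powerGram {N : ℕ} (m : ℕ) (X : Matrix (Fin N) (Fin N) ℂ) : Matrix (Fin N) (Fin N) ℂ :=
  X ^ m * Xᴴ ^ m

theorem powerGram_isHermitian {N : ℕ} (m : ℕ) (X : Matrix (Fin N) (Fin N) ℂ) :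
    (powerGram m X).IsHermitian := by
  unfold powerGram
  rw [← Matrix.conjTranspose_pow]
  exact Matrix.isHermitian_mul_conjTranspose_self _

/-- The empirical distribution function `N⁻¹ ∑ k, 𝟙{λ_k ≤ t}`, where `λ_1, …, λ_N` are the
eigenvalues, with multiplicity, of `X^m (X^*)^m`, that is, the squared singular values of `X^m`. -/
def empiricalDF {N : ℕ} (m : ℕ) (X : Matrix (Fin N) (Fin N) ℂ) (t : ℝ) : ℝ :=
  (N : ℝ)⁻¹ * ∑ k : Fin N,
    Set.indicator (Set.Iic t) (fun _ => (1 : ℝ)) ((powerGram_isHermitian m X).eigenvalues k)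

/-- `μ` is a probability measure on the line all of whose moments exist, the `p`-th one being the
Fuss–Catalan number `binom (mp + p) p / (mp + 1)`. -/
structure IsFussCatalanLaw (m : ℕ) (μ : Measure ℝ) : Prop where
  isProbabilityMeasure : IsProbabilityMeasure μ
  integrable_pow : ∀ p : ℕ, Integrable (fun s : ℝ => s ^ p) μ
  moment_eq : ∀ p : ℕ,
    ∫ s : ℝ, s ^ p ∂μ = 1 / ((m : ℝ) * (p : ℝ) + 1) * ((m * p + p).choose p : ℝ)

end

/-! The proof is the moment method after truncation. The normalized expected trace of a word in `X`
and `Xᴴ` is a sum over closed walks on the `N` indices. By independence the expectation of a walk is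
a product, over the matrix entries used, of mixed moments (`integral_entryProd`). After truncation
and scaling every moment of positive order is at most `1/N`, and those of order other than 2 are
`o(1/N)`. A walk uses at least as many entries as it discovers fresh vertices, and the sum over all
walks of `N^(-fresh vertices)` is bounded in `N` (`sum_walks_pow_newCard_le`). Hence walks with a
surplus entry, or with an entry used neither 0 nor 2 times, are negligible. What survives are
depth-first tours of trees (`stackWalk_of_card`). They traverse each entry once by `X` and once by
`Xᴴ`, so only `E|x|^2` enters and `E x^2` plays no role. The limit is the number of runs of a stack
automaton, that is, of noncrossing pairings of opposite letters (`stackCount`).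

For the word of `(X^m (X^*)^m)^p` this number is found from the generating function `C`. Pairing off
the letters of the first ascent gives `C = 1 + z C^(m+1)`, and Raney's formula gives the
coefficients. The recursion needs the count to be the same at every starting phase of the periodic
word. This cyclic invariance is read off the cyclicity of the trace, since both counts are limits of
the same expected traces.

The limit law is exhibited as a constant times a product of `m` independent beta variables, which
has compact support and no atoms (`exists_isFussCatalanLaw`). Polynomials that lie above and below a
half-line indicator on the whole line, and are close to it in mean, give both uniqueness
(`eq_of_moments`) and convergence of distribution functions (`tendsto_integral_empiricalDF`).

Finally, the fourth moment allows a truncation level of order `o(√N)` at which all `N^2` entries are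
unchanged with probability tending to one (`exists_truncation`), and the distribution functions are
bounded by one, so truncation does not affect the limit. -/

/-! ### Noncrossing pairings of words, counted by a stack automaton. -/

/-- The number of ways to read the word `w` in two mutually inverse letters by a stack automaton
that at each letter either pushes the opposite letter or pops the same letter, starting with the
stack `s` and ending with the empty one. -/
def stackCount : List Bool → List Bool → ℕ
  | [], [] => 1
  | [], _ :: _ => 0
  | a :: w, [] => stackCount w [!a]
  | a :: w, b :: s => stackCount w ((!a) :: b :: s) + if a = b then stackCount w s else 0

/-- The window of length `n`, starting at `i`, of an infinite word. -/
def window (l : ℕ → Bool) (i : ℕ) : ℕ → List Bool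
  | 0 => []
  | n + 1 => l i :: window l (i + 1) n

theorem window_add (l : ℕ → Bool) (i n k : ℕ) :
    window l i (n + k) = window l i n ++ window l (i + n) k := by
  induction n generalizing i with
  | zero => simp [window]
  | succ n ih =>
    rw [Nat.add_right_comm, window, ih, window]
    simp [Nat.add_assoc, Nat.add_comm 1 n]

theorem window_congr {l l' : ℕ → Bool} {i j n : ℕ} (h : ∀ k < n, l (i + k) = l' (j + k)) :
    window l i n = window l' j n := by
  induction n generalizing i j with
  | zero => rfl
  | succ n ih =>
    rw [window, window, ih (i := i + 1) (j := j + 1)]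
    · rw [show l i = l' j from h 0 (by omega)]
    · intro k hk
      have := h (k + 1) (by omega)
      rwa [show i + 1 + k = i + (k + 1) by omega, show j + 1 + k = j + (k + 1) by omega]

/-- Split at the letter, at offset `k`, that pops `b`. The letters before it act on `s` as if `b`
were the bottom, and those after it act on `s'`. -/
theorem stackCount_window_append (l : ℕ → Bool) (b : Bool) (s' : List Bool) (n i : ℕ)
    (s : List Bool) :
    stackCount (window l i n) (s ++ b :: s') =
      ∑ k ∈ Finset.range n, if l (i + k) = b then
        stackCount (window l i k) s * stackCount (window l (i + k + 1) (n - 1 - k)) s' else 0 := by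
  induction n generalizing i s with
  | zero => cases s <;> rfl
  | succ n ih =>
    have h0 : ∀ a s, stackCount (window l i 0) (a :: s) = 0 := fun _ _ => rfl
    rw [Finset.sum_range_succ']
    have hs : ∀ s₀ : List Bool, (∑ k ∈ Finset.range n, if l (i + 1 + k) = b then
        stackCount (window l (i + 1) k) s₀ *
          stackCount (window l (i + 1 + k + 1) (n - 1 - k)) s' else 0) =
        ∑ k ∈ Finset.range n, if l (i + (k + 1)) = b then
        stackCount (window l (i + 1) k) s₀ *
          stackCount (window l (i + (k + 1) + 1) (n + 1 - 1 - (k + 1))) s' else 0 := by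
      intro s₀
      refine Finset.sum_congr rfl fun k _ => ?_
      rw [show i + 1 + k = i + (k + 1) by omega, show n + 1 - 1 - (k + 1) = n - 1 - k by omega]
    cases s with
    | nil =>
      have h1 := ih (i + 1) [!l i]
      rw [hs] at h1
      simp only [List.cons_append, List.nil_append] at h1
      simp only [window, List.nil_append, stackCount, h1]
      simp
    | cons a s =>
      have h1 := ih (i + 1) ((!l i) :: a :: s)
      have h2 := ih (i + 1) s
      rw [hs] at h1 h2
      simp only [List.cons_append] at h1
      -- The term `k = 0` vanishes: the empty word cannot clear the nonempty stack above `b`.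
      rw [h0, zero_mul, ite_self, add_zero]
      simp only [window, List.cons_append, stackCount, h1, h2]
      by_cases hla : l i = a
      · simp only [hla, if_true]
        rw [← Finset.sum_add_distrib]
        refine Finset.sum_congr rfl fun k _ => ?_
        split_ifs <;> ring
      · simp [hla]

/-- Catalan-type decomposition at the partner of the first letter, which separates the enclosed word
from the remaining one. -/
theorem stackCount_window_succ (l : ℕ → Bool) (n i : ℕ) :
    stackCount (window l i (n + 1)) [] =
      ∑ k ∈ Finset.range n, if l (i + 1 + k) = !l i then
        stackCount (window l (i + 1) k) [] *
          stackCount (window l (i + 1 + k + 1) (n - 1 - k)) [] else 0 :=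
  stackCount_window_append l (!l i) [] n (i + 1) []

/-- The number of `true` minus the number of `false` in a word. -/
def wordHeight : List Bool → ℤ
  | [] => 0
  | a :: w => (if a then 1 else -1) + wordHeight w

/-- Pushing `!a` or popping `a` while reading `a` lowers the height of the stack by that of `a`. So
the height of the unread word minus that of the stack is invariant, and it is zero at the end of a
successful run. -/
theorem wordHeight_eq_of_stackCount_ne_zero {w s : List Bool} (h : stackCount w s ≠ 0) :
    wordHeight w = wordHeight s := by
  induction w generalizing s with
  | nil => cases s with
    | nil => rfl
    | cons b s => exact absurd rfl h
  | cons a w ih =>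
    cases s with
    | nil =>
      have := ih (s := [!a]) (by simpa only [stackCount] using h)
      change (if a then (1 : ℤ) else -1) + wordHeight w = 0
      rw [this]
      cases a <;> simp [wordHeight]
    | cons b s =>
      rw [stackCount] at h
      by_cases h1 : stackCount w ((!a) :: b :: s) = 0
      · rw [h1, zero_add] at h
        by_cases hab : a = b
        · rw [if_pos hab] at h
          rw [wordHeight, wordHeight, ih h, hab]
        · simp [hab] at h
      · have := ih h1
        rw [wordHeight, this]
        cases a <;> simp [wordHeight]

/-! ### Raney's formula and the Fuss–Catalan generating function. -/

/-- The coefficients of the powers of a solution of `C = 1 + z C ^ (m + 1)`. -/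
theorem raney_coeff (m : ℕ) (C : PowerSeries ℚ) (hC : C = 1 + PowerSeries.X * C ^ (m + 1))
    (p r : ℕ) :
    (((m : ℚ) + 1) * p + r) * PowerSeries.coeff p (C ^ r) = r * (((m + 1) * p + r).choose p : ℕ) := by
  have hC0 : PowerSeries.constantCoeff C = 1 := by rw [hC]; simp
  induction p generalizing r with
  | zero => simp [hC0]
  | succ p ihp =>
    induction r with
    | zero => simp
    | succ r ihr =>
      have hrec : C ^ (r + 1) = C ^ r + PowerSeries.X * C ^ (r + (m + 1)) := by
        calc C ^ (r + 1) = C ^ r * C := pow_succ _ _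
          _ = C ^ r * (1 + PowerSeries.X * C ^ (m + 1)) := by rw [← hC]
          _ = _ := by ring
      have h1 := ihp (r + (m + 1))
      rw [hrec, map_add, PowerSeries.coeff_succ_X_mul]
      set u := PowerSeries.coeff (p + 1) (C ^ r)
      set v := PowerSeries.coeff p (C ^ (r + (m + 1)))
      -- At the exponents `r` and `r + m + 1` the two induction hypotheses have the same prefactor
      -- and the same upper binomial index `M`, so the step reduces to Pascal's rule.
      obtain ⟨M, hM⟩ : ∃ M, M = (m + 1) * (p + 1) + r := ⟨_, rfl⟩
      have hM' : (M : ℚ) = (m + 1) * (p + 1) + r := by rw [hM]; push_cast; ring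
      rw [show (m + 1) * (p + 1) + r = M from hM.symm] at ihr
      rw [show (m + 1) * p + (r + (m + 1)) = M by rw [hM]; ring] at h1
      rw [show (m + 1) * (p + 1) + (r + 1) = M + 1 by rw [hM]; ring, Nat.choose_succ_succ]
      have hpM : p ≤ M := by rw [hM]; nlinarith
      have hch : ((M.choose (p + 1) : ℕ) : ℚ) * (p + 1) = (M.choose p : ℕ) * (M - p) := by
        have := Nat.choose_succ_right_eq M p
        rw [← Nat.cast_sub hpM]
        exact_mod_cast this
      have hMpos : (M : ℚ) ≠ 0 := by rw [hM']; positivity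
      push_cast at *
      set x : ℚ := (M.choose p : ℚ)
      set y : ℚ := (M.choose (p + 1) : ℚ)
      have e1 : (M : ℚ) * u = r * y := by rw [← ihr, hM']
      have e2 : (M : ℚ) * v = (r + (m + 1)) * x := by rw [← h1, hM']; ring
      apply mul_left_cancel₀ hMpos
      have e3 : ((m : ℚ) + 1) * (p + 1) = M - r := by rw [hM']; ring
      have e4 : ((m : ℚ) + 1) * (y * (p + 1)) = (m + 1) * (x * (M - p)) := by rw [hch]
      have e5 : ((m : ℚ) + 1) * (p + 1) + (r + 1) = M + 1 := by rw [hM']; ring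
      rw [e5]
      have e6 : y * (M - r) = (m + 1) * (x * (M - p)) := by rw [← e4, ← e3]; ring
      linear_combination (M + 1 : ℚ) * (e1 + e2) - e6 + x * e3

theorem fussCatalan_coeff (m : ℕ) (C : PowerSeries ℚ)
    (hC : C = 1 + PowerSeries.X * C ^ (m + 1)) (p : ℕ) :
    PowerSeries.coeff p C = 1 / ((m : ℚ) * p + 1) * ((m * p + p).choose p : ℕ) := by
  have h := raney_coeff m C hC p 1
  rw [pow_one] at h
  have h1 := Nat.add_one_mul_choose_eq (m * p + p) p
  have h2 := Nat.choose_succ_right_eq (m * p + p + 1) p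
  have h3 : (m * p + p + 1).choose p * (m * p + 1) = (m * p + p + 1) * (m * p + p).choose p := by
    rw [h1, h2]; congr 1; omega
  rw [show (m + 1) * p + 1 = m * p + p + 1 by ring] at h
  have h4 : (((m * p + p + 1).choose p : ℕ) : ℚ) * (m * p + 1) =
      (m * p + p + 1) * ((m * p + p).choose p : ℕ) := by exact_mod_cast h3
  have h5 : (m : ℚ) * p + 1 ≠ 0 := by positivity
  have h6 : (m : ℚ) * p + p + 1 ≠ 0 := by positivity
  field_simp
  apply mul_left_cancel₀ h6
  rw [← h4]
  push_cast at h
  linear_combination (m * p + 1 : ℚ) * h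

/-! ### The zigzag word and its noncrossing pairings. -/

/-- The periodic word `X^m (X^*)^m X^m (X^*)^m ⋯`. -/
def zigzag (m i : ℕ) : Bool := decide (i % (2 * m) < m)

/-- The height of the zigzag path at `i`. -/
def zigzagHeight (m i : ℕ) : ℤ :=
  if i % (2 * m) < m then ((i % (2 * m) : ℕ) : ℤ) else 2 * m - ((i % (2 * m) : ℕ) : ℤ)

theorem wordHeight_window_zigzag {m : ℕ} (hm : 1 ≤ m) (n i : ℕ) :
    wordHeight (window (zigzag m) i n) = zigzagHeight m (i + n) - zigzagHeight m i := by
  induction n generalizing i with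
  | zero => simp [window, wordHeight]
  | succ n ih =>
    rw [window, wordHeight, ih, show i + 1 + n = i + (n + 1) by omega]
    have key : zigzagHeight m (i + 1) = zigzagHeight m i + if zigzag m i then 1 else -1 := by
      simp only [zigzagHeight, zigzag, decide_eq_true_eq]
      have h1 := Nat.div_add_mod i (2 * m)
      have h2 := Nat.mod_lt i (show 0 < 2 * m by omega)
      have h3 : (i + 1) % (2 * m) = if i % (2 * m) + 1 = 2 * m then 0 else i % (2 * m) + 1 := by
        rw [Nat.add_mod]
        by_cases h2m : 2 * m = 1
        · omega
        rw [Nat.mod_eq_of_lt (show 1 < 2 * m by omega)]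
        split_ifs with h
        · rw [h, Nat.mod_self]
        · exact Nat.mod_eq_of_lt (by omega)
      rw [h3]
      split_ifs <;> omega
    rw [key]; ring

/-- Position `k < m` is an up-step from height `k`, so its partner is a down-step back to height
`k`, one choice for each `j ≤ b`. The enclosed window starts at height `k + 1`. What follows the
partner is `b - j` whole periods at another phase, which `hc` makes irrelevant. -/
theorem stackCount_zigzag_rec {m : ℕ} (hm : 1 ≤ m) (c : ℕ → ℕ)
    (hc : ∀ i q, stackCount (window (zigzag m) i (2 * m * q)) [] = c q)
    {k : ℕ} (hk : k < m) (b : ℕ) :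
    stackCount (window (zigzag m) k (2 * (m - k) + 2 * m * b)) [] =
      ∑ j ∈ Finset.range (b + 1),
        stackCount (window (zigzag m) (k + 1) (2 * (m - (k + 1)) + 2 * m * j)) [] * c (b - j) := by
  rw [show 2 * (m - k) + 2 * m * b = (2 * (m - k) + 2 * m * b - 1) + 1 by omega,
    stackCount_window_succ]
  have hk1 : zigzag m k = true := by
    simp only [zigzag, decide_eq_true_eq]
    rwa [Nat.mod_eq_of_lt (by omega)]
  symm
  have hmod : ∀ j, (k + 1 + (2 * (m - (k + 1)) + 2 * m * j)) % (2 * m) = 2 * m - k - 1 := by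
    intro j
    rw [show k + 1 + (2 * (m - (k + 1)) + 2 * m * j) = (2 * m - k - 1) + 2 * m * j by omega,
      Nat.add_mul_mod_self_left, Nat.mod_eq_of_lt (by omega)]
  refine Finset.sum_of_injOn (fun j => 2 * (m - (k + 1)) + 2 * m * j) ?_ ?_ ?_ ?_
  · intro j _ j' _ h
    have : 2 * m * j = 2 * m * j' := by simpa using h
    exact Nat.eq_of_mul_eq_mul_left (by omega) this
  · intro j hj
    have hj' : j ≤ b := by simpa [Nat.lt_succ_iff] using hj
    have := Nat.mul_le_mul_left (2 * m) hj'
    simp only [Finset.coe_range, Set.mem_Iio]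
    omega
  -- At other positions the term is zero: a pairable enclosed word has height 0, so its right end is
  -- at height `k + 1` on a descent, which forces the residue `2m - k - 1`.
  · intro i hi hni
    split_ifs with hz
    · by_contra hne
      have hne1 := left_ne_zero_of_mul hne
      have hh := wordHeight_eq_of_stackCount_ne_zero hne1
      rw [wordHeight_window_zigzag hm] at hh
      have hz' : ¬ (k + 1 + i) % (2 * m) < m := by
        rw [hk1] at hz
        simpa [zigzag] using hz
      have hd := Nat.div_add_mod (k + 1 + i) (2 * m)
      have h2 := Nat.mod_lt (k + 1 + i) (show 0 < 2 * m by omega)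
      simp only [zigzagHeight, if_neg hz', wordHeight] at hh
      have hk2 : (k + 1) % (2 * m) = k + 1 := Nat.mod_eq_of_lt (by omega)
      rw [hk2] at hh
      have hr : (k + 1 + i) % (2 * m) = 2 * m - k - 1 := by
        split_ifs at hh <;> omega
      apply hni
      refine ⟨(k + 1 + i) / (2 * m), ?_, ?_⟩
      · simp only [Finset.coe_range, Set.mem_Iio]
        by_contra hlt
        have := Nat.mul_le_mul_left (2 * m) (not_lt.mp hlt)
        have hi' := Finset.mem_range.mp hi
        rw [Nat.mul_succ] at this
        omega
      · simp only
        omega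
    · rfl
  · intro j hj
    have hj' : j ≤ b := by simpa [Nat.lt_succ_iff] using hj
    have hz : zigzag m (k + 1 + (2 * (m - (k + 1)) + 2 * m * j)) = !zigzag m k := by
      rw [hk1, zigzag, hmod]
      simp; omega
    rw [if_pos hz]
    congr 1
    obtain ⟨e, rfl⟩ := Nat.exists_eq_add_of_le hj'
    rw [← hc (k + 1 + (2 * (m - (k + 1)) + 2 * m * j) + 1) (j + e - j)]
    congr 2
    rw [show j + e - j = e by omega, mul_add]
    omega

/-- A solution of the balanced-word recursion is given by the Fuss–Catalan numbers. -/
theorem stackCount_zigzag {m : ℕ} (hm : 1 ≤ m) (c : ℕ → ℕ)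
    (hc : ∀ i q, stackCount (window (zigzag m) i (2 * m * q)) [] = c q) (p : ℕ) :
    (c p : ℚ) = 1 / ((m : ℚ) * p + 1) * ((m * p + p).choose p : ℕ) := by
  set C : PowerSeries ℚ := PowerSeries.mk fun q => (c q : ℚ) with hCdef
  -- `R k` counts windows that start on the ascent at height `k` and end on a descent at the same
  -- height. Peeling off up-steps one at a time gives `R 0 = C ^ (m + 1)`.
  set R : ℕ → PowerSeries ℚ := fun k => PowerSeries.mk fun b =>
    (stackCount (window (zigzag m) k (2 * (m - k) + 2 * m * b)) [] : ℚ) with hR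
  have hRm : R m = C := by
    ext b
    simp [hR, hCdef, hc]
  have hstep : ∀ k < m, R k = R (k + 1) * C := by
    intro k hk
    ext b
    rw [PowerSeries.coeff_mul, Finset.Nat.sum_antidiagonal_eq_sum_range_succ_mk]
    simp only [hR, hCdef, PowerSeries.coeff_mk]
    rw [stackCount_zigzag_rec hm c hc hk]
    push_cast
    rfl
  have hpow : ∀ j ≤ m, R (m - j) = C ^ (j + 1) := by
    intro j hj
    induction j with
    | zero => simp [hRm]
    | succ j ih =>
      rw [hstep _ (by omega), show m - (j + 1) + 1 = m - j by omega, ih (by omega), ← pow_succ]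
  have hR0 := hpow m le_rfl
  rw [Nat.sub_self] at hR0
  -- A nonempty run of whole periods from phase 0 is a window counted by `R 0`, with index lowered
  -- by one.
  have hCeq : C = 1 + PowerSeries.X * C ^ (m + 1) := by
    rw [← hR0]
    ext b
    cases b with
    | zero =>
      have : c 0 = 1 := by rw [← hc 0 0]; rfl
      simp [hCdef, this]
    | succ b =>
      rw [map_add, PowerSeries.coeff_succ_X_mul]
      simp only [hCdef, hR, PowerSeries.coeff_mk, PowerSeries.coeff_one]
      rw [← hc 0 (b + 1)]
      simp [Nat.mul_add, add_comm]
  have := fussCatalan_coeff m C hCeq p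
  rwa [hCdef, PowerSeries.coeff_mk] at this

/-! ### Walks, the matrix entries they use, and stack walks. -/

/-- The matrix entry used by a step from `u` to `v` along the letter `a`. -/
def stepEntry {V : Type*} (a : Bool) (u v : V) : V × V := if a then (u, v) else (v, u)

/-- The letters and the matrix entries used by a walk. -/
def walkEntries {V : Type*} : V → List Bool → List V → List (Bool × (V × V))
  | v, a :: w, u :: us => (a, stepEntry a v u) :: walkEntries u w us
  | _, [], _ => []
  | _, _ :: _, [] => []

/-- The letters and entries that lead along a stack to its top vertex `v`. -/
def stackEntries {V : Type*} : V → List (V × Bool) → List (Bool × (V × V))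
  | _, [] => []
  | v, (p, a) :: st => (a, stepEntry a p v) :: stackEntries p st

/-- Walks that at each step either go to a fresh vertex or back along the edge by which the
current vertex was first reached, and end at the bottom of the stack. -/
inductive StackWalk {V : Type*} [DecidableEq V] :
    Finset V → V → List (V × Bool) → List Bool → List V → Prop
  | nil (S : Finset V) (v : V) : StackWalk S v [] [] []
  | push {S : Finset V} {v u : V} {st : List (V × Bool)} {a : Bool} {w : List Bool} {us : List V}
      (hu : u ∉ S) (h : StackWalk (insert u S) u ((v, a) :: st) w us) :
      StackWalk S v st (a :: w) (u :: us)
  | pop {S : Finset V} {v p : V} {st : List (V × Bool)} {a : Bool} {w : List Bool} {us : List V}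
      (h : StackWalk S p st w us) : StackWalk S v ((p, !a) :: st) (a :: w) (p :: us)

/-- The number of vertices of a list outside of a finite set. -/
def newCard {V : Type*} [DecidableEq V] (S : Finset V) (us : List V) : ℕ := (us.toFinset \ S).card

section
variable {V : Type*}

theorem stepEntry_endpoint_right (a : Bool) (u v : V) :
    v = (stepEntry a u v).1 ∨ v = (stepEntry a u v).2 := by
  cases a <;> simp [stepEntry]

theorem stepEntry_endpoint_left (a : Bool) (u v : V) :
    u = (stepEntry a u v).1 ∨ u = (stepEntry a u v).2 := by
  cases a <;> simp [stepEntry]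

theorem eq_and_eq_not_of_stepEntry_eq {a b : Bool} {u v p : V}
    (h : stepEntry a v u = stepEntry b p v) (hvp : v ≠ p) : u = p ∧ b = !a := by
  cases a <;> cases b <;> simp only [stepEntry] at h <;> simp_all

theorem stepEntry_mem {S : Finset V} {u v : V} (a : Bool) (hu : u ∈ S) (hv : v ∈ S) :
    (stepEntry a u v).1 ∈ S ∧ (stepEntry a u v).2 ∈ S := by
  cases a <;> simp [stepEntry, hu, hv]

theorem mem_of_mem_stackEntries {v : V} {st : List (V × Bool)} {e : V × V}
    (he : e ∈ (stackEntries v st).map Prod.snd) :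
    e.1 ∈ v :: st.map Prod.fst ∧ e.2 ∈ v :: st.map Prod.fst := by
  induction st generalizing v with
  | nil => simp [stackEntries] at he
  | cons q st ih =>
    obtain ⟨p, a⟩ := q
    simp only [stackEntries, List.map_cons, List.mem_cons] at he
    rcases he with rfl | he
    · cases a <;> simp [stepEntry]
    · have := ih he
      exact ⟨List.mem_cons_of_mem _ (by simpa using this.1),
        List.mem_cons_of_mem _ (by simpa using this.2)⟩

theorem mem_of_mem_stack {v : V} {st : List (V × Bool)} {S : Finset V} (hv : v ∈ S)
    (h : ∀ e ∈ (stackEntries v st).map Prod.snd, e.1 ∈ S ∧ e.2 ∈ S) :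
    ∀ p ∈ v :: st.map Prod.fst, p ∈ S := by
  induction st generalizing v with
  | nil => simpa using hv
  | cons q st ih =>
    obtain ⟨p, a⟩ := q
    simp only [stackEntries, List.map_cons, List.mem_cons] at h
    have hp : p ∈ S := by
      have := h _ (Or.inl rfl)
      rcases stepEntry_endpoint_left a p v with h1 | h1
      · rw [h1]; exact this.1
      · rw [h1]; exact this.2
    intro x hx
    rcases List.mem_cons.mp hx with rfl | hx
    · exact hv
    · exact ih hp (fun e he => h e (Or.inr he)) x (by simpa using hx)

end

section
variable {V : Type*} [DecidableEq V]

theorem newCard_cons_of_mem {S : Finset V} {u : V} (hu : u ∈ S) (us : List V) :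
    newCard S (u :: us) = newCard S us := by
  rw [newCard, newCard, List.toFinset_cons, Finset.insert_sdiff_of_mem _ hu]

theorem card_insert_sdiff_of_notMem {α : Type*} [DecidableEq α] {S T : Finset α} {u : α}
    (hu : u ∉ S) : (insert u T \ S).card = (T \ insert u S).card + 1 := by
  rw [Finset.insert_sdiff_of_notMem _ hu, Finset.sdiff_insert,
    ← Finset.card_insert_of_notMem (Finset.notMem_erase u (T \ S))]
  congr 1
  ext x; by_cases hx : x = u <;> simp [hx]

theorem newCard_cons_of_notMem {S : Finset V} {u : V} (hu : u ∉ S) (us : List V) :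
    newCard S (u :: us) = newCard (insert u S) us + 1 := by
  rw [newCard, newCard, List.toFinset_cons, card_insert_sdiff_of_notMem hu]

/-- The entry by which a fresh vertex is first reached has that vertex as an endpoint, so it differs
from all earlier entries and from those in `K`. -/
theorem newCard_le_card_entries (w : List Bool) (us : List V) (hl : us.length = w.length)
    (v : V) (S : Finset V) (hv : v ∈ S) (K : Finset (V × V)) (hK : ∀ e ∈ K, e.1 ∈ S ∧ e.2 ∈ S) :
    newCard S us ≤ (((walkEntries v w us).map Prod.snd).toFinset \ K).card := by
  induction w generalizing us v S K with
  | nil =>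
    obtain rfl := List.length_eq_zero_iff.mp hl
    simp [newCard]
  | cons a w ih =>
    obtain ⟨u, us, rfl⟩ := List.exists_cons_of_length_eq_add_one hl
    have hl' : us.length = w.length := by simpa using hl
    rw [walkEntries, List.map_cons, List.toFinset_cons]
    by_cases hu : u ∈ S
    · rw [newCard_cons_of_mem hu]
      refine (ih us hl' u S hu K hK).trans (Finset.card_le_card ?_)
      exact Finset.sdiff_subset_sdiff (Finset.subset_insert _ _) le_rfl
    · have he : stepEntry a v u ∉ K := by
        intro h
        rcases stepEntry_endpoint_right a v u with h1 | h1
        · exact hu (h1 ▸ (hK _ h).1)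
        · exact hu (h1 ▸ (hK _ h).2)
      rw [newCard_cons_of_notMem hu, card_insert_sdiff_of_notMem he, Nat.add_le_add_iff_right]
      refine ih us hl' u _ (Finset.mem_insert_self _ _) _ ?_
      intro e he'
      rcases Finset.mem_insert.mp he' with rfl | h
      · exact stepEntry_mem a (Finset.mem_insert_of_mem hv) (Finset.mem_insert_self _ _)
      · exact ⟨Finset.mem_insert_of_mem (hK e h).1, Finset.mem_insert_of_mem (hK e h).2⟩

/-- A walk with as many fresh vertices as fresh entries that uses every entry twice or never is a
stack walk. -/
theorem stackWalk_of_card (w : List Bool) (us : List V) (hl : us.length = w.length)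
    (v : V) (st : List (V × Bool)) (S : Finset V) (hv : v ∈ S)
    (hnd : (v :: st.map Prod.fst).Nodup) (D : Finset (V × V))
    (hD : ∀ e ∈ D, e.1 ∈ S ∧ e.2 ∈ S)
    (hP : ∀ e ∈ (stackEntries v st).map Prod.snd, e.1 ∈ S ∧ e.2 ∈ S)
    (hcD : ∀ e ∈ D, ((walkEntries v w us).map Prod.snd).count e = 0)
    (hcP : ∀ e ∈ (stackEntries v st).map Prod.snd,
      ((walkEntries v w us).map Prod.snd).count e = 1)
    (hc : ∀ e, e ∉ D → e ∉ (stackEntries v st).map Prod.snd →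
      ((walkEntries v w us).map Prod.snd).count e = 0 ∨
      ((walkEntries v w us).map Prod.snd).count e = 2)
    (hcard : (((walkEntries v w us).map Prod.snd).toFinset \
      (D ∪ ((stackEntries v st).map Prod.snd).toFinset)).card ≤ newCard S us) :
    StackWalk S v st w us := by
  -- Invariant: `D` holds the entries already used twice, the stack those used once and still to be
  -- reversed. All of them have endpoints among the visited vertices `S`.
  induction w generalizing us v st S D with
  | nil =>
    obtain rfl := List.length_eq_zero_iff.mp hl
    cases st with
    | nil => exact StackWalk.nil S v
    | cons q st =>
      have := hcP (stepEntry q.2 q.1 v) (by simp [stackEntries])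
      simp [walkEntries] at this
  | cons a w ih =>
    obtain ⟨u, us, rfl⟩ := List.exists_cons_of_length_eq_add_one hl
    have hl' : us.length = w.length := by simpa using hl
    set K := D ∪ ((stackEntries v st).map Prod.snd).toFinset with hKdef
    have hK : ∀ e ∈ K, e.1 ∈ S ∧ e.2 ∈ S := by
      intro e he
      rcases Finset.mem_union.mp he with h | h
      · exact hD e h
      · exact hP e (List.mem_toFinset.mp h)
    set e₀ := stepEntry a v u with he₀
    simp only [walkEntries, List.map_cons, ← he₀, List.count_cons, beq_iff_eq] at hcD hcP hc
    rw [walkEntries, List.map_cons, List.toFinset_cons] at hcard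
    change Finset.card (insert e₀ ((walkEntries u w us).map Prod.snd).toFinset \ K) ≤ _ at hcard
    by_cases hu : u ∈ S
    · rw [newCard_cons_of_mem hu] at hcard
      -- An unseen entry between visited vertices would be a surplus: the rest of the walk needs a
      -- further new entry for each fresh vertex, which exceeds `hcard`.
      have heK : e₀ ∈ K := by
        by_contra he
        rw [card_insert_sdiff_of_notMem he] at hcard
        have := newCard_le_card_entries w us hl' u S hu (insert e₀ K) (by
          intro e he'
          rcases Finset.mem_insert.mp he' with rfl | h
          · exact stepEntry_mem a hv hu
          · exact hK e h)
        omega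
      have heD : e₀ ∉ D := by
        intro h
        have := hcD e₀ h
        simp at this
      have heP : e₀ ∈ (stackEntries v st).map Prod.snd := by
        rcases Finset.mem_union.mp heK with h | h
        · exact absurd h heD
        · exact List.mem_toFinset.mp h
      cases st with
      | nil => simp [stackEntries] at heP
      | cons q st =>
        obtain ⟨p, b⟩ := q
        simp only [List.map_cons, List.nodup_cons] at hnd
        obtain ⟨hvn, hpn, hstn⟩ := hnd
        simp only [stackEntries, List.map_cons, List.mem_cons] at heP hP hcP hc
        have hnotin : ∀ e ∈ (stackEntries p st).map Prod.snd, e.1 ≠ v ∧ e.2 ≠ v := by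
          intro e he
          have := mem_of_mem_stackEntries he
          exact ⟨fun h => hvn (h ▸ this.1), fun h => hvn (h ▸ this.2)⟩
        have hvp : v ≠ p := fun h => hvn (by simp [h])
        -- The vertices on the stack are distinct, so only the top entry touches `v`.
        have htop : e₀ = stepEntry b p v := by
          rcases heP with h | h
          · exact h
          · have h1 := hnotin _ h
            rcases stepEntry_endpoint_left a v u with h2 | h2
            · exact absurd h2.symm h1.1
            · exact absurd h2.symm h1.2
        obtain ⟨rfl, rfl⟩ := eq_and_eq_not_of_stepEntry_eq htop hvp
        refine StackWalk.pop ?_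
        have hpe : ∀ e ∈ (stackEntries u st).map Prod.snd, e ≠ e₀ := by
          intro e he h
          have h1 := hnotin e he
          rcases stepEntry_endpoint_left a v u with h2 | h2
          · exact h1.1 (by rw [h, ← h2])
          · exact h1.2 (by rw [h, ← h2])
        -- The entry has now been used twice, so it moves from the stack to `D`.
        refine ih us hl' u st S hu ?_ (insert e₀ D) ?_ ?_ ?_ ?_ ?_ ?_
        · exact List.nodup_cons.mpr ⟨hpn, hstn⟩
        · intro e he
          rcases Finset.mem_insert.mp he with rfl | h
          · exact stepEntry_mem a hv hu
          · exact hD e h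
        · exact fun e he => hP e (Or.inr he)
        · intro e he
          rcases Finset.mem_insert.mp he with rfl | h
          · have := hcP e₀ (Or.inl htop)
            simpa using this
          · have := hcD e h
            omega
        · intro e he
          have := hcP e (Or.inr he)
          rwa [if_neg (fun h => hpe e he h.symm), add_zero] at this
        · intro e heD' heP'
          rw [Finset.mem_insert, not_or] at heD'
          have := hc e heD'.2 (by rw [not_or]; exact ⟨fun h => heD'.1 (h.trans htop.symm), heP'⟩)
          rwa [if_neg (fun h => heD'.1 h.symm), add_zero] at this
        · refine le_trans (Finset.card_le_card ?_) hcard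
          intro x hx
          simp only [hKdef, stackEntries, List.map_cons, List.toFinset_cons, Finset.mem_sdiff,
            Finset.mem_union, Finset.mem_insert, not_or, ← htop] at hx ⊢
          exact ⟨Or.inr hx.1, hx.2.1.2, hx.2.1.1, hx.2.2⟩
    · have heK : e₀ ∉ K := by
        intro h
        rcases stepEntry_endpoint_right a v u with h1 | h1
        · exact hu (h1 ▸ (hK _ h).1)
        · exact hu (h1 ▸ (hK _ h).2)
      have heD : e₀ ∉ D := fun h => heK (Finset.mem_union_left _ h)
      have heP : e₀ ∉ (stackEntries v st).map Prod.snd :=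
        fun h => heK (Finset.mem_union_right _ (List.mem_toFinset.mpr h))
      rw [newCard_cons_of_notMem hu, card_insert_sdiff_of_notMem heK,
        Nat.add_le_add_iff_right] at hcard
      refine StackWalk.push hu ?_
      refine ih us hl' u _ _ (Finset.mem_insert_self _ _) ?_ D ?_ ?_ ?_ ?_ ?_ ?_
      · rw [List.map_cons, List.nodup_cons]
        exact ⟨fun h => hu (mem_of_mem_stack hv hP u h), hnd⟩
      · exact fun e he =>
          ⟨Finset.mem_insert_of_mem (hD e he).1, Finset.mem_insert_of_mem (hD e he).2⟩
      · intro e he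
        simp only [stackEntries, List.map_cons, List.mem_cons] at he
        rcases he with rfl | he
        · exact stepEntry_mem a (Finset.mem_insert_of_mem hv) (Finset.mem_insert_self _ _)
        · exact ⟨Finset.mem_insert_of_mem (hP e he).1, Finset.mem_insert_of_mem (hP e he).2⟩
      · intro e he
        have := hcD e he
        omega
      · intro e he
        simp only [stackEntries, List.map_cons, List.mem_cons] at he
        rcases he with rfl | he
        · have := hc e₀ heD heP
          simpa using this
        · have := hcP e he
          rwa [if_neg (fun h => heP (by rw [h]; exact he)), add_zero] at this
      · intro e he1 he2
        simp only [stackEntries, List.map_cons, List.mem_cons, not_or] at he2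
        have := hc e he1 he2.2
        rwa [if_neg (fun h => he2.1 h.symm), add_zero] at this
      · refine le_trans (Finset.card_le_card ?_) hcard
        intro x hx
        simp only [hKdef, stackEntries, List.map_cons, List.toFinset_cons, Finset.mem_sdiff,
          Finset.mem_union, Finset.mem_insert, not_or, he₀] at hx ⊢
        exact ⟨hx.1, hx.2.2.1, hx.2.1, hx.2.2.2⟩

/-- A stack walk traverses its stack backwards and every other entry once along each letter. -/
theorem StackWalk.exists_perm {S : Finset V} {v : V} {st : List (V × Bool)} {w : List Bool}
    {us : List V} (h : StackWalk S v st w us) (K : Finset (V × V)) (hv : v ∈ S)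
    (hK : ∀ e ∈ K, e.1 ∈ S ∧ e.2 ∈ S)
    (hst : ∀ p ∈ st, p.1 ∈ S) :
    ∃ F : List (V × V), F.Nodup ∧ (∀ e ∈ F, e ∉ K) ∧ F.length = newCard S us ∧
      List.Perm (walkEntries v w us)
        ((stackEntries v st).map (fun x => (!x.1, x.2)) ++
          F.flatMap fun e => [(true, e), (false, e)]) := by
  induction h generalizing K with
  | nil S v => exact ⟨[], List.nodup_nil, by simp, by simp [newCard], by simp [walkEntries, stackEntries]⟩
  | @push S v u st a w us hu h ih =>
    have heK : stepEntry a v u ∉ K := by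
      intro h
      rcases stepEntry_endpoint_right a v u with h1 | h1
      · exact hu (h1 ▸ (hK _ h).1)
      · exact hu (h1 ▸ (hK _ h).2)
    obtain ⟨F, hF, hFK, hFl, hperm⟩ := ih (insert (stepEntry a v u) K)
      (Finset.mem_insert_self _ _) (by
        intro e he
        rcases Finset.mem_insert.mp he with rfl | h
        · exact stepEntry_mem a (Finset.mem_insert_of_mem hv) (Finset.mem_insert_self _ _)
        · exact ⟨Finset.mem_insert_of_mem (hK e h).1, Finset.mem_insert_of_mem (hK e h).2⟩) (by
        intro p hp
        rcases List.mem_cons.mp hp with rfl | hp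
        · exact Finset.mem_insert_of_mem hv
        · exact Finset.mem_insert_of_mem (hst p hp))
    refine ⟨stepEntry a v u :: F, ?_, ?_, ?_, ?_⟩
    · exact List.nodup_cons.mpr ⟨fun h => hFK _ h (Finset.mem_insert_self _ _), hF⟩
    · intro e he
      rcases List.mem_cons.mp he with rfl | he
      · exact heK
      · exact fun h => hFK e he (Finset.mem_insert_of_mem h)
    · rw [List.length_cons, hFl, newCard_cons_of_notMem hu]
    · rw [walkEntries]
      refine (hperm.cons _).trans ?_
      simp only [stackEntries, List.map_cons, List.flatMap_cons, List.cons_append, List.nil_append]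
      set e := stepEntry a v u
      -- The first use is the push. The second comes from the top of the stack of the remaining walk
      -- and is the pop, along the opposite letter.
      have h1 : List.Perm [(a, e), (!a, e)] [(true, e), (false, e)] := by
        cases a
        · exact List.Perm.swap _ _ _
        · exact List.Perm.refl _
      refine (h1.append_right _).trans ?_
      simp only [List.cons_append, List.nil_append]
      have h2 := @List.perm_append_comm_assoc _ [(true, e), (false, e)]
        ((stackEntries v st).map fun x => (!x.1, x.2)) (F.flatMap fun e => [(true, e), (false, e)])
      simpa using h2
  | @pop S v p st a w us h ih =>
    have hp : p ∈ S := hst (p, !a) (by simp)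
    obtain ⟨F, hF, hFK, hFl, hperm⟩ := ih K hp hK (fun q hq => hst q (by simp [hq]))
    refine ⟨F, hF, hFK, by rw [hFl, newCard_cons_of_mem hp], ?_⟩
    have : stepEntry (!a) p v = stepEntry a v p := by cases a <;> rfl
    simp only [walkEntries, stackEntries, List.map_cons, List.cons_append, Bool.not_not, this]
    exact hperm.cons _

theorem StackWalk.length_eq {S : Finset V} {v : V} {st : List (V × Bool)} {w : List Bool}
    {us : List V} (h : StackWalk S v st w us) : us.length = w.length := by
  induction h <;> simp_all

/-- The last vertex of a walk. -/
def walkEnd {V : Type*} : V → List V → V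
  | v, [] => v
  | _, u :: us => walkEnd u us

theorem StackWalk.walkEnd_eq {S : Finset V} {v : V} {st : List (V × Bool)} {w : List Bool}
    {us : List V} (h : StackWalk S v st w us) :
    walkEnd v us = walkEnd v (st.map Prod.fst) := by
  induction h with
  | nil => rfl
  | push hu h ih => exact ih
  | pop h ih => exact ih

end

/-! ### Summation over walks. -/

/-- Prepending an element to a list, as an embedding. -/
def consEmbedding (V : Type*) : V × List V ↪ List V where
  toFun p := p.1 :: p.2
  inj' p q h := by simpa [Prod.ext_iff] using h

/-- The lists of length `n` with elements in a finite type. -/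
def walks (V : Type*) [Fintype V] : ℕ → Finset (List V)
  | 0 => {[]}
  | n + 1 => (Finset.univ ×ˢ walks V n).map (consEmbedding V)

theorem sum_walks_zero {V R : Type*} [Fintype V] [AddCommMonoid R] (F : List V → R) :
    ∑ us ∈ walks V 0, F us = F [] := by simp [walks]

theorem sum_walks_succ {V R : Type*} [Fintype V] [AddCommMonoid R] (n : ℕ) (F : List V → R) :
    ∑ us ∈ walks V (n + 1), F us = ∑ u, ∑ us ∈ walks V n, F (u :: us) := by
  rw [walks, Finset.sum_map, Finset.sum_product]
  rfl

theorem length_of_mem_walks {V : Type*} [Fintype V] {n : ℕ} {us : List V} (h : us ∈ walks V n) :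
    us.length = n := by
  induction n generalizing us with
  | zero => simp_all [walks]
  | succ n ih =>
    simp only [walks, Finset.mem_map, Finset.mem_product] at h
    obtain ⟨p, hp, rfl⟩ := h
    exact congrArg (· + 1) (ih hp.2)

theorem length_walkEntries {V : Type*} (v : V) (w : List Bool) (us : List V) (h : us.length = w.length) :
    (walkEntries v w us).length = w.length := by
  induction w generalizing v us with
  | nil => simp [walkEntries]
  | cons a w ih =>
    obtain ⟨u, us, rfl⟩ := List.exists_cons_of_length_eq_add_one h
    simp [walkEntries, ih u us (by simpa using h)]

section
variable {V : Type*} [DecidableEq V]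

theorem stackWalk_cons_of_notMem {S : Finset V} {v u : V} {st : List (V × Bool)} {a : Bool}
    {w : List Bool} {us : List V} (hst : ∀ p ∈ st, p.1 ∈ S) (hu : u ∉ S) :
    StackWalk S v st (a :: w) (u :: us) ↔ StackWalk (insert u S) u ((v, a) :: st) w us := by
  constructor
  · intro h
    cases h with
    | push _ h => exact h
    | pop h => exact absurd (hst (u, !a) (by simp)) hu
  · exact StackWalk.push hu

theorem stackWalk_cons_of_mem {S : Finset V} {v u : V} {st : List (V × Bool)} {a : Bool}
    {w : List Bool} {us : List V} (hu : u ∈ S) :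
    StackWalk S v st (a :: w) (u :: us) ↔
      ∃ st', st = (u, !a) :: st' ∧ StackWalk S u st' w us := by
  constructor
  · intro h
    cases h with
    | push hu' _ => exact absurd hu hu'
    | pop h => exact ⟨_, rfl, h⟩
  · rintro ⟨st', rfl, h⟩
    exact StackWalk.pop h

theorem count_add_count (l : List (Bool × (V × V))) (e : V × V) :
    l.count (true, e) + l.count (false, e) = (l.map Prod.snd).count e := by
  induction l with
  | nil => simp
  | cons x l ih =>
    obtain ⟨a, f⟩ := x
    rw [List.map_cons, List.count_cons, List.count_cons, List.count_cons, ← ih]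
    cases a <;> by_cases h : f = e <;> simp [h] <;> omega

end

section
variable {V : Type*} [Fintype V] [DecidableEq V]

/-- At each step the fresh vertices contribute at most `N · N⁻¹ = 1` and the visited ones their
number, which grows by at most one per step. The point is that the bound does not depend on `N` when
`S` has a fixed number of elements. -/
theorem sum_walks_pow_newCard_le (n : ℕ) (S : Finset V) :
    ∑ us ∈ walks V n, ((Fintype.card V : ℝ)⁻¹) ^ newCard S us ≤ ((S.card + n + 1 : ℕ) : ℝ) ^ n := by
  set q : ℝ := (Fintype.card V : ℝ)⁻¹ with hq
  have hq0 : 0 ≤ q := by positivity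
  induction n generalizing S with
  | zero => simp [sum_walks_zero, newCard]
  | succ n ih =>
    rw [sum_walks_succ]
    set B : ℝ := ((S.card + (n + 1) + 1 : ℕ) : ℝ) ^ n with hB
    have hB0 : 0 ≤ B := by positivity
    have h1 : ∀ u : V, ∑ us ∈ walks V n, q ^ newCard S (u :: us) ≤
        (if u ∈ S then B else 0) + q * B := by
      intro u
      by_cases hu : u ∈ S
      · simp only [newCard_cons_of_mem hu, if_pos hu]
        have h2 : ((S.card + n + 1 : ℕ) : ℝ) ^ n ≤ B :=
          pow_le_pow_left₀ (by positivity) (by exact_mod_cast (by omega)) n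
        have := (ih S).trans h2
        have : 0 ≤ q * B := by positivity
        linarith
      · simp only [newCard_cons_of_notMem hu, if_neg hu, zero_add, pow_succ']
        rw [← Finset.mul_sum]
        refine mul_le_mul_of_nonneg_left ((ih (insert u S)).trans_eq ?_) hq0
        rw [Finset.card_insert_of_notMem hu, hB]
        congr 2; omega
    refine (Finset.sum_le_sum fun u _ => h1 u).trans ?_
    rw [Finset.sum_add_distrib, Finset.sum_ite_mem, Finset.univ_inter, Finset.sum_const,
      Finset.sum_const, Finset.card_univ, nsmul_eq_mul, nsmul_eq_mul, ← mul_assoc]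
    have h3 : (Fintype.card V : ℝ) * q ≤ 1 := mul_inv_le_one
    have h4 : (Fintype.card V : ℝ) * q * B ≤ 1 * B := mul_le_mul_of_nonneg_right h3 hB0
    have h5 : (S.card : ℝ) * B + 1 * B ≤ ((S.card + (n + 1) + 1 : ℕ) : ℝ) * B := by
      rw [← add_mul]
      refine mul_le_mul_of_nonneg_right ?_ hB0
      push_cast
      linarith [(Nat.cast_nonneg n : (0 : ℝ) ≤ n)]
    rw [pow_succ']
    linarith

end

/-- The normalized number of stack walks when `k` of the `N` vertices have been visited. -/
noncomputable def stackWeight (N : ℕ) : List Bool → List Bool → ℕ → ℝ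
  | [], [], _ => 1
  | [], _ :: _, _ => 0
  | a :: w, [], k => ((N : ℝ) - k) / N * stackWeight N w [!a] (k + 1)
  | a :: w, b :: s, k => ((N : ℝ) - k) / N * stackWeight N w ((!a) :: b :: s) (k + 1) +
      if a = b then stackWeight N w s k else 0

/-- Each push carries a factor `(N - k) / N → 1`, so in the limit each run of the automaton counts
once. -/
theorem tendsto_stackWeight (w s : List Bool) (k : ℕ) :
    Tendsto (fun N => stackWeight N w s k) atTop (𝓝 (stackCount w s : ℝ)) := by
  have hk : ∀ k : ℕ, Tendsto (fun N : ℕ => ((N : ℝ) - k) / N) atTop (𝓝 1) := by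
    intro k
    have h1 : Tendsto (fun N : ℕ => 1 - (k : ℝ) / N) atTop (𝓝 (1 - 0)) :=
      tendsto_const_nhds.sub (tendsto_const_div_atTop_nhds_zero_nat (k : ℝ))
    rw [sub_zero] at h1
    refine h1.congr' ?_
    filter_upwards [eventually_gt_atTop 0] with N hN
    have : (N : ℝ) ≠ 0 := by exact_mod_cast hN.ne'
    field_simp
  induction w generalizing s k with
  | nil => cases s <;> simp [stackWeight, stackCount]
  | cons a w ih =>
    cases s with
    | nil =>
      simp only [stackWeight, stackCount]
      simpa using (hk k).mul (ih [!a] (k + 1))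
    | cons b s =>
      simp only [stackWeight, stackCount]
      have h1 := (hk k).mul (ih ((!a) :: b :: s) (k + 1))
      rw [one_mul] at h1
      push_cast
      refine h1.add ?_
      split_ifs with h
      · exact ih s k
      · exact tendsto_const_nhds

section
variable {V : Type*} [Fintype V] [DecidableEq V]

-- A push has `N - |S|` targets, each weighted by `N⁻¹`, and a pop has one. The letters of the stack
-- are negated because a vertex reached along `a` is left backwards along `!a`, which is the letter
-- that the automaton stores.
open Classical in
theorem sum_stackWalk (w : List Bool) (S : Finset V) (v : V) (st : List (V × Bool))
    (hv : v ∈ S) (hst : ∀ p ∈ st, p.1 ∈ S) :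
    ∑ us ∈ walks V w.length, (if StackWalk S v st w us then
      ((Fintype.card V : ℝ)⁻¹) ^ newCard S us else 0) =
      stackWeight (Fintype.card V) w (st.map fun p => !p.2) S.card := by
  set q : ℝ := (Fintype.card V : ℝ)⁻¹ with hq
  induction w generalizing S v st with
  | nil =>
    rw [List.length_nil, sum_walks_zero]
    cases st with
    | nil => simp [StackWalk.nil, newCard, stackWeight]
    | cons p st =>
      rw [if_neg (fun h => by cases h)]
      rfl
  | cons a w ih =>
    rw [List.length_cons, sum_walks_succ]
    set A : ℝ := stackWeight (Fintype.card V) w ((!a) :: st.map fun p => !p.2) (S.card + 1) with hA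
    set B : V → ℝ := fun u => ∑ us ∈ walks V w.length,
      if ∃ st', st = (u, !a) :: st' ∧ StackWalk S u st' w us then q ^ newCard S us else 0 with hB
    have h1 : ∀ u, ∑ us ∈ walks V w.length, (if StackWalk S v st (a :: w) (u :: us) then
        q ^ newCard S (u :: us) else 0) = (q * A - if u ∈ S then q * A else 0) +
          if u ∈ S then B u else 0 := by
      intro u
      by_cases hu : u ∈ S
      · simp only [if_pos hu, sub_self, zero_add, stackWalk_cons_of_mem hu,
          newCard_cons_of_mem hu, hB]
      · simp only [if_neg hu, sub_zero, add_zero, stackWalk_cons_of_notMem hst hu,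
          newCard_cons_of_notMem hu, pow_succ']
        have := ih (insert u S) u ((v, a) :: st) (Finset.mem_insert_self _ _) (by
          intro p hp
          rcases List.mem_cons.mp hp with rfl | hp
          · exact Finset.mem_insert_of_mem hv
          · exact Finset.mem_insert_of_mem (hst p hp))
        rw [Finset.card_insert_of_notMem hu] at this
        rw [hA, ← List.map_cons (f := fun p : V × Bool => !p.2) (a := (v, a)), ← this,
          Finset.mul_sum]
        refine Finset.sum_congr rfl fun us _ => ?_
        rw [mul_ite, mul_zero]
    rw [Finset.sum_congr rfl fun u _ => h1 u, Finset.sum_add_distrib, Finset.sum_sub_distrib,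
      Finset.sum_ite_mem, Finset.sum_ite_mem, Finset.univ_inter, Finset.sum_const,
      Finset.sum_const, Finset.card_univ, nsmul_eq_mul, nsmul_eq_mul, ← sub_mul]
    have h2 : ((Fintype.card V : ℝ) - S.card) * (q * A) =
        ((Fintype.card V : ℝ) - S.card) / (Fintype.card V : ℝ) * A := by
      rw [hq]; ring
    rw [h2]
    cases st with
    | nil =>
      simp only [List.map_nil, stackWeight, hA, hB]
      simp
    | cons p st =>
      obtain ⟨p, b⟩ := p
      simp only [List.map_cons, stackWeight, hA, hB]
      congr 1
      have hp : p ∈ S := hst (p, b) (by simp)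
      rw [Finset.sum_eq_single_of_mem p hp]
      · by_cases hab : a = !b
        · subst hab
          rw [if_pos rfl, ← ih S p st hp (fun q hq => hst q (by simp [hq]))]
          refine Finset.sum_congr rfl fun us _ => ?_
          simp
        · rw [if_neg hab]
          refine Finset.sum_eq_zero fun us _ => ?_
          rw [if_neg]
          rintro ⟨st', h, _⟩
          simp only [List.cons.injEq, Prod.mk.injEq, true_and] at h
          exact hab (by rw [h.1, Bool.not_not])
      · intro u _ hup
        refine Finset.sum_eq_zero fun us _ => ?_
        rw [if_neg]
        rintro ⟨st', h, _⟩
        simp only [List.cons.injEq, Prod.mk.injEq] at h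
        exact hup h.1.1.symm

/-! ### Matrix words as sums over walks, and the weights of walks. -/

/-- The product of the entries of `A` and of their conjugates over a list. -/
def entryProd (A : V × V → ℂ) (l : List (Bool × (V × V))) : ℂ :=
  (l.map fun x => if x.1 then A x.2 else star (A x.2)).prod

/-- The product of matrices `A` and `Aᴴ` along a word. -/
def wordProd (A : Matrix V V ℂ) (w : List Bool) : Matrix V V ℂ :=
  (w.map fun a => if a then A else Aᴴ).prod

theorem wordProd_apply (A : Matrix V V ℂ) (w : List Bool) (v z : V) :
    wordProd A w v z = ∑ us ∈ walks V w.length, if walkEnd v us = z then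
      entryProd (fun e => A e.1 e.2) (walkEntries v w us) else 0 := by
  induction w generalizing v with
  | nil =>
    rw [List.length_nil, sum_walks_zero]
    simp [wordProd, walkEnd, walkEntries, entryProd, Matrix.one_apply]
  | cons a w ih =>
    have : wordProd A (a :: w) = (if a then A else Aᴴ) * wordProd A w := by simp [wordProd]
    rw [this, Matrix.mul_apply, List.length_cons, sum_walks_succ]
    refine Finset.sum_congr rfl fun u _ => ?_
    rw [ih, Finset.mul_sum]
    refine Finset.sum_congr rfl fun us _ => ?_
    rw [mul_ite, mul_zero]
    simp only [walkEnd, walkEntries]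
    congr 1
    cases a <;> simp [entryProd, stepEntry, Matrix.conjTranspose_apply]

/-- The product over all entries of the mixed moments counted by a list. -/
def momentWeight (M : ℕ → ℕ → ℂ) (l : List (Bool × (V × V))) : ℂ :=
  ∏ e, M (l.count (true, e)) (l.count (false, e))

/-- Each distinct entry used costs a factor `q`, and unused entries contribute 1. -/
theorem norm_momentWeight_le {M : ℕ → ℕ → ℂ} {q : ℝ} (h0 : M 0 0 = 1)
    (h1 : ∀ a b, a + b ≠ 0 → ‖M a b‖ ≤ q) (l : List (Bool × (V × V))) :
    ‖momentWeight M l‖ ≤ q ^ ((l.map Prod.snd).toFinset).card := by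
  rw [momentWeight, norm_prod, ← Finset.prod_const,
    ← Finset.prod_subset (Finset.subset_univ (l.map Prod.snd).toFinset)]
  · refine Finset.prod_le_prod (fun _ _ => norm_nonneg _) fun e he => h1 _ _ ?_
    rw [count_add_count]
    exact (List.count_pos_iff.mpr (List.mem_toFinset.mp he)).ne'
  · intro e _ he
    have := count_add_count l e
    rw [List.count_eq_zero_of_not_mem (fun h => he (List.mem_toFinset.mpr h))] at this
    rw [show l.count (true, e) = 0 by omega, show l.count (false, e) = 0 by omega, h0, norm_one]

/-- An entry used neither 0 nor 2 times gives the additional factor `η`. -/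
theorem norm_momentWeight_le_mul {M : ℕ → ℕ → ℂ} {q η : ℝ} (h0 : M 0 0 = 1)
    (h1 : ∀ a b, a + b ≠ 0 → ‖M a b‖ ≤ q)
    (h2 : ∀ a b, a + b ≠ 0 → a + b ≠ 2 → ‖M a b‖ ≤ q * η) (l : List (Bool × (V × V)))
    (e₀ : V × V) (he0 : (l.map Prod.snd).count e₀ ≠ 0) (he2 : (l.map Prod.snd).count e₀ ≠ 2) :
    ‖momentWeight M l‖ ≤ q ^ ((l.map Prod.snd).toFinset).card * η := by
  have hmem : e₀ ∈ (l.map Prod.snd).toFinset :=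
    List.mem_toFinset.mpr (List.count_pos_iff.mp (Nat.pos_of_ne_zero he0))
  rw [momentWeight, norm_prod,
    ← Finset.prod_subset (Finset.subset_univ (l.map Prod.snd).toFinset),
    ← Finset.mul_prod_erase _ _ hmem]
  · have h3 : ∏ e ∈ ((l.map Prod.snd).toFinset).erase e₀,
        ‖M (l.count (true, e)) (l.count (false, e))‖ ≤
        q ^ (((l.map Prod.snd).toFinset).erase e₀).card := by
      rw [← Finset.prod_const]
      refine Finset.prod_le_prod (fun _ _ => norm_nonneg _) fun e he => h1 _ _ ?_
      rw [count_add_count]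
      exact (List.count_pos_iff.mpr (List.mem_toFinset.mp (Finset.mem_of_mem_erase he))).ne'
    have h4 := h2 (l.count (true, e₀)) (l.count (false, e₀)) (by rwa [count_add_count])
      (by rwa [count_add_count])
    rw [← Finset.card_erase_add_one hmem, pow_succ]
    calc _ ≤ (q * η) * q ^ (((l.map Prod.snd).toFinset).erase e₀).card :=
          mul_le_mul h4 h3 (Finset.prod_nonneg fun _ _ => norm_nonneg _)
            ((norm_nonneg _).trans h4)
      _ = _ := by ring
  · intro e _ he
    have := count_add_count l e
    rw [List.count_eq_zero_of_not_mem (fun h => he (List.mem_toFinset.mpr h))] at this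
    rw [show l.count (true, e) = 0 by omega, show l.count (false, e) = 0 by omega, h0, norm_one]

theorem momentWeight_pairs {M : ℕ → ℕ → ℂ} (h0 : M 0 0 = 1) {l : List (Bool × (V × V))}
    {F : List (V × V)} (hF : F.Nodup)
    (hl : List.Perm l (F.flatMap fun e => [(true, e), (false, e)])) :
    momentWeight M l = M 1 1 ^ F.length := by
  have hc : ∀ (a : Bool) (e : V × V), l.count (a, e) = F.count e := by
    intro a e
    rw [hl.count_eq]
    clear hl hF
    induction F with
    | nil => simp
    | cons f F ih =>
      rw [List.flatMap_cons, List.count_append, ih, List.count_cons]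
      cases a <;> by_cases h : f = e <;> simp [h] <;> omega
  rw [momentWeight, ← List.toFinset_card_of_nodup hF, ← Finset.prod_const,
    ← Finset.prod_subset (Finset.subset_univ F.toFinset)]
  · refine Finset.prod_congr rfl fun e he => ?_
    rw [hc, hc, List.count_eq_one_of_mem hF (List.mem_toFinset.mp he)]
  · intro e _ he
    rw [hc, hc, List.count_eq_zero_of_not_mem (fun h => he (List.mem_toFinset.mpr h)), h0]

open Classical in
/-- The sum of the weights of the closed walks from `v` is close to that of the stack walks. -/
theorem norm_sum_momentWeight_sub_le {M : ℕ → ℕ → ℂ} {η : ℝ}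
    (h0 : M 0 0 = 1) (h1 : ∀ a b, a + b ≠ 0 → ‖M a b‖ ≤ (Fintype.card V : ℝ)⁻¹)
    (h2 : ∀ a b, a + b ≠ 0 → a + b ≠ 2 → ‖M a b‖ ≤ (Fintype.card V : ℝ)⁻¹ * η)
    (w : List Bool) (v : V) :
    ‖(∑ us ∈ walks V w.length, if walkEnd v us = v then momentWeight M (walkEntries v w us) else 0)
      - ((Fintype.card V : ℂ) * M 1 1) ^ (w.length / 2) *
        (stackWeight (Fintype.card V) w [] 1 : ℝ)‖
      ≤ max η ((Fintype.card V : ℝ)⁻¹) * ((w.length + 2 : ℕ) : ℝ) ^ w.length := by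
  set q : ℝ := (Fintype.card V : ℝ)⁻¹ with hq
  have hcard : (Fintype.card V : ℂ) ≠ 0 := by
    have : 0 < Fintype.card V := Fintype.card_pos_iff.mpr ⟨v⟩
    exact_mod_cast this.ne'
  have hq0 : 0 ≤ q := by positivity
  have h3 := sum_stackWalk w {v} v [] (by simp) (by simp)
  rw [List.map_nil, Finset.card_singleton] at h3
  rw [← h3, Complex.ofReal_sum, Finset.mul_sum, ← Finset.sum_sub_distrib]
  have h4 := sum_walks_pow_newCard_le w.length ({v} : Finset V)
  rw [Finset.card_singleton, show 1 + w.length + 1 = w.length + 2 by omega] at h4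
  -- The comparison is termwise: stack walks cancel exactly, and each other walk is at most `max η
  -- q` times its term in the uniformly bounded sum `h4`.
  refine le_trans ?_ (mul_le_mul_of_nonneg_left h4 (hq0.trans (le_max_right η q)))
  rw [Finset.mul_sum]
  refine (norm_sum_le _ _).trans (Finset.sum_le_sum fun us hus => ?_)
  have hl := length_of_mem_walks hus
  have hpos : 0 ≤ max η q * q ^ newCard {v} us :=
    mul_nonneg (hq0.trans (le_max_right η q)) (by positivity)
  by_cases hsw : StackWalk {v} v [] w us
  · have hend : walkEnd v us = v := hsw.walkEnd_eq
    obtain ⟨F, hF, -, hFl, hperm⟩ := hsw.exists_perm ∅ (by simp) (by simp) (by simp)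
    simp only [stackEntries, List.map_nil, List.nil_append] at hperm
    rw [if_pos hend, if_pos hsw, momentWeight_pairs h0 hF hperm]
    have hlen := hperm.length_eq
    rw [length_walkEntries v w us hl] at hlen
    have hlen2 : w.length / 2 = F.length := by
      have : (F.flatMap fun e => [(true, e), (false, e)]).length = F.length * 2 := by
        simp [List.length_flatMap]
      omega
    rw [hlen2, ← hFl]
    have : ((Fintype.card V : ℂ) * M 1 1) ^ F.length * ((((Fintype.card V : ℝ)⁻¹) ^ F.length : ℝ) : ℂ)
        = M 1 1 ^ F.length := by
      push_cast
      rw [← mul_pow]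
      congr 1
      field_simp
    rw [this, sub_self, norm_zero, hFl]
    exact hpos
  · rw [if_neg hsw, Complex.ofReal_zero, mul_zero, sub_zero]
    have key : ‖momentWeight M (walkEntries v w us)‖ ≤ max η q * q ^ newCard {v} us := by
      have hle := newCard_le_card_entries w us hl v {v} (by simp) ∅ (by simp)
      rw [Finset.sdiff_empty] at hle
      have hq1 : q ≤ 1 := by
        rw [hq]
        have : 0 < Fintype.card V := Fintype.card_pos_iff.mpr ⟨v⟩
        exact inv_le_one_of_one_le₀ (by exact_mod_cast this)
      -- Either there is a surplus entry, worth a factor `q`, or some entry has multiplicity other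
      -- than 0 and 2, worth a factor `η`. Otherwise `stackWalk_of_card` would make the walk a stack
      -- walk.
      rcases hle.lt_or_eq with hlt | heq
      · calc _ ≤ q ^ _ := norm_momentWeight_le h0 h1 _
          _ ≤ q ^ (newCard {v} us + 1) := pow_le_pow_of_le_one hq0 hq1 hlt
          _ = q * q ^ newCard {v} us := pow_succ' _ _
          _ ≤ _ := mul_le_mul_of_nonneg_right (le_max_right _ _) (by positivity)
      · obtain ⟨e, he0, he2⟩ : ∃ e, ((walkEntries v w us).map Prod.snd).count e ≠ 0 ∧
            ((walkEntries v w us).map Prod.snd).count e ≠ 2 := by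
          by_contra hcon
          push Not at hcon
          refine hsw (stackWalk_of_card w us hl v [] {v} (by simp) (by simp) ∅ (by simp)
            (by simp [stackEntries]) (by simp) (by simp [stackEntries]) ?_ ?_)
          · intro e _ _
            by_cases h : ((walkEntries v w us).map Prod.snd).count e = 0
            · exact Or.inl h
            · exact Or.inr (hcon e h)
          · simp only [stackEntries, List.map_nil, List.toFinset_nil, Finset.union_empty,
              Finset.sdiff_empty]
            exact heq.ge
        calc _ ≤ q ^ _ * η := norm_momentWeight_le_mul h0 h1 h2 _ e he0 he2
          _ = η * q ^ newCard {v} us := by rw [← heq, mul_comm]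
          _ ≤ _ := mul_le_mul_of_nonneg_right (le_max_left _ _) (by positivity)
    split_ifs
    · exact key
    · rw [norm_zero]; exact hpos

end

/-! ### Expected traces of words in a matrix with independent entries. -/

theorem norm_entryProd_le {V : Type*} {A : V × V → ℂ} {C : ℝ} (hA : ∀ e, ‖A e‖ ≤ C)
    (l : List (Bool × (V × V))) : ‖entryProd A l‖ ≤ C ^ l.length := by
  induction l with
  | nil => simp [entryProd]
  | cons x l ih =>
    have h1 : entryProd A (x :: l) = (if x.1 then A x.2 else star (A x.2)) * entryProd A l := by
      simp [entryProd]
    rw [h1, norm_mul, List.length_cons, pow_succ']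
    have h2 : ‖(if x.1 then A x.2 else star (A x.2))‖ ≤ C := by
      split_ifs
      · exact hA _
      · rw [norm_star]; exact hA _
    exact mul_le_mul h2 ih (norm_nonneg _) ((norm_nonneg _).trans h2)

section
variable {V : Type*} [Fintype V] [DecidableEq V]

theorem entryProd_eq_prod (A : V × V → ℂ) (l : List (Bool × (V × V))) :
    entryProd A l = ∏ e, (A e ^ l.count (true, e) * star (A e) ^ l.count (false, e)) := by
  induction l with
  | nil => simp [entryProd]
  | cons x l ih =>
    obtain ⟨a, f⟩ := x
    have h1 : entryProd A ((a, f) :: l) = (if a then A f else star (A f)) * entryProd A l := by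
      simp [entryProd]
    have h2 : (if a then A f else star (A f)) =
        ∏ e, if e = f then (if a then A e else star (A e)) else 1 := by
      rw [Finset.prod_ite_eq' Finset.univ f, if_pos (Finset.mem_univ f)]
    rw [h1, ih, h2, ← Finset.prod_mul_distrib]
    refine Finset.prod_congr rfl fun e _ => ?_
    rw [List.count_cons, List.count_cons]
    by_cases h : e = f
    · subst h
      cases a <;> simp [pow_succ] <;> ring
    · have h' : ¬ f = e := fun h'' => h h''.symm
      simp [h, h']

variable {Ω₀ Ω : Type*} [MeasurableSpace Ω₀] [MeasurableSpace Ω] {P₀ : Measure Ω₀} {P : Measure Ω}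

theorem aestronglyMeasurable_entryProd {X : V × V → Ω → ℂ} (hX : ∀ e, AEMeasurable (X e) P)
    {g : ℂ → ℂ} (hg : Measurable g) (l : List (Bool × (V × V))) :
    AEStronglyMeasurable (fun ω => entryProd (fun e => g (X e ω)) l) P := by
  simp only [entryProd_eq_prod]
  refine AEMeasurable.aestronglyMeasurable ?_
  refine Finset.aemeasurable_fun_prod _ fun e _ => ?_
  have h1 : AEMeasurable (fun ω => g (X e ω)) P := hg.comp_aemeasurable (hX e)
  have h2 : AEMeasurable (fun ω => star (g (X e ω))) P := by
    have : Measurable (fun z : ℂ => star z) := continuous_star.measurable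
    exact this.comp_aemeasurable h1
  exact (h1.pow_const _).mul (h2.pow_const _)

theorem integrable_entryProd [IsFiniteMeasure P] {X : V × V → Ω → ℂ}
    (hX : ∀ e, AEMeasurable (X e) P) {g : ℂ → ℂ} (hg : Measurable g) {C : ℝ}
    (hC : ∀ z, ‖g z‖ ≤ C) (l : List (Bool × (V × V))) :
    Integrable (fun ω => entryProd (fun e => g (X e ω)) l) P :=
  Integrable.of_bound (aestronglyMeasurable_entryProd hX hg l) (C ^ l.length)
    (ae_of_all _ fun _ => norm_entryProd_le (fun _ => hC _) l)

/-- The mixed moments of `g` under the law of `x`. -/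
noncomputable def mixedMoment (P₀ : Measure Ω₀) (x : Ω₀ → ℂ) (g : ℂ → ℂ) (a b : ℕ) : ℂ :=
  ∫ ω, g (x ω) ^ a * star (g (x ω)) ^ b ∂P₀

/-- Grouping the factors by matrix entry lets independence split the expectation into mixed moments
of the single variable `x`. -/
theorem integral_entryProd {x : Ω₀ → ℂ} {X : V × V → Ω → ℂ}
    (hX : ∀ e, IdentDistrib (X e) x P P₀) (hindep : iIndepFun X P) {g : ℂ → ℂ}
    (hg : Measurable g) (l : List (Bool × (V × V))) :
    ∫ ω, entryProd (fun e => g (X e ω)) l ∂P = momentWeight (mixedMoment P₀ x g) l := by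
  simp only [entryProd_eq_prod]
  have hm : ∀ a b : ℕ, Measurable fun z : ℂ => g z ^ a * star (g z) ^ b := by
    intro a b
    have : Measurable (fun z : ℂ => star z) := continuous_star.measurable
    exact (hg.pow_const _).mul ((this.comp hg).pow_const _)
  rw [hindep.integral_fun_prod_comp (f := fun e z =>
      g z ^ l.count (true, e) * star (g z) ^ l.count (false, e))
    (fun e => (hX e).aemeasurable_fst) (fun e => (hm _ _).aestronglyMeasurable)]
  refine Finset.prod_congr rfl fun e _ => ?_
  exact ((hX e).comp (hm _ _)).integral_eq

theorem integrable_trace_wordProd [IsFiniteMeasure P] {X : V × V → Ω → ℂ}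
    (hX : ∀ e, AEMeasurable (X e) P) {g : ℂ → ℂ} (hg : Measurable g) {C : ℝ}
    (hC : ∀ z, ‖g z‖ ≤ C) (w : List Bool) :
    Integrable (fun ω => (wordProd (Matrix.of fun i j => g (X (i, j) ω)) w).trace) P := by
  simp only [Matrix.trace, Matrix.diag_apply, wordProd_apply]
  refine integrable_finsetSum _ fun v _ => integrable_finsetSum _ fun us _ => ?_
  split_ifs
  · exact integrable_entryProd hX hg hC _
  · exact integrable_zero _ _ _

theorem integral_trace_wordProd [IsFiniteMeasure P] {x : Ω₀ → ℂ} {X : V × V → Ω → ℂ}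
    (hX : ∀ e, IdentDistrib (X e) x P P₀) (hindep : iIndepFun X P) {g : ℂ → ℂ}
    (hg : Measurable g) {C : ℝ} (hC : ∀ z, ‖g z‖ ≤ C) (w : List Bool) :
    ∫ ω, (wordProd (Matrix.of fun i j => g (X (i, j) ω)) w).trace ∂P =
      ∑ v, ∑ us ∈ walks V w.length, if walkEnd v us = v then
        momentWeight (mixedMoment P₀ x g) (walkEntries v w us) else 0 := by
  have hint : ∀ (v : V) (us : List V), Integrable (fun ω => if walkEnd v us = v then
      entryProd (fun e => (Matrix.of fun i j => g (X (i, j) ω)) e.1 e.2)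
        (walkEntries v w us) else 0) P := by
    intro v us
    split_ifs
    · exact integrable_entryProd (fun e => (hX e).aemeasurable_fst) hg hC _
    · exact integrable_zero _ _ _
  simp only [Matrix.trace, Matrix.diag_apply, wordProd_apply]
  rw [integral_finsetSum _ fun v _ => integrable_finsetSum _ fun us _ => hint v us]
  refine Finset.sum_congr rfl fun v _ => ?_
  rw [integral_finsetSum _ fun us _ => hint v us]
  refine Finset.sum_congr rfl fun us _ => ?_
  split_ifs
  · exact integral_entryProd hX hindep hg _
  · exact integral_zero _ _

/-- The normalized expected trace of a word is close to the normalized number of stack walks. -/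
theorem norm_integral_trace_sub_le [Nonempty V] [IsFiniteMeasure P] {x : Ω₀ → ℂ}
    {X : V × V → Ω → ℂ}
    (hX : ∀ e, IdentDistrib (X e) x P P₀) (hindep : iIndepFun X P) {g : ℂ → ℂ}
    (hg : Measurable g) {C : ℝ} (hC : ∀ z, ‖g z‖ ≤ C) {η : ℝ}
    (h0 : mixedMoment P₀ x g 0 0 = 1)
    (h1 : ∀ a b, a + b ≠ 0 → ‖mixedMoment P₀ x g a b‖ ≤ (Fintype.card V : ℝ)⁻¹)
    (h2 : ∀ a b, a + b ≠ 0 → a + b ≠ 2 →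
      ‖mixedMoment P₀ x g a b‖ ≤ (Fintype.card V : ℝ)⁻¹ * η)
    (w : List Bool) :
    ‖(Fintype.card V : ℂ)⁻¹ * ∫ ω, (wordProd (Matrix.of fun i j => g (X (i, j) ω)) w).trace ∂P -
      ((Fintype.card V : ℂ) * mixedMoment P₀ x g 1 1) ^ (w.length / 2) *
        (stackWeight (Fintype.card V) w [] 1 : ℝ)‖
      ≤ max η ((Fintype.card V : ℝ)⁻¹) * ((w.length + 2 : ℕ) : ℝ) ^ w.length := by
  rw [integral_trace_wordProd hX hindep hg hC]
  set A : ℂ := ((Fintype.card V : ℂ) * mixedMoment P₀ x g 1 1) ^ (w.length / 2) *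
        (stackWeight (Fintype.card V) w [] 1 : ℝ)
  set B : ℝ := max η ((Fintype.card V : ℝ)⁻¹) * ((w.length + 2 : ℕ) : ℝ) ^ w.length
  have hcard : 0 < Fintype.card V := Fintype.card_pos
  have hA : A = (Fintype.card V : ℂ)⁻¹ * ∑ _v : V, A := by
    rw [Finset.sum_const, Finset.card_univ, nsmul_eq_mul, ← mul_assoc, inv_mul_cancel₀, one_mul]
    exact_mod_cast hcard.ne'
  have hB : B = (Fintype.card V : ℝ)⁻¹ * ∑ _v : V, B := by
    rw [Finset.sum_const, Finset.card_univ, nsmul_eq_mul, ← mul_assoc, inv_mul_cancel₀, one_mul]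
    exact_mod_cast hcard.ne'
  rw [hA, hB, ← mul_sub, ← Finset.sum_sub_distrib, norm_mul, norm_inv, Complex.norm_natCast]
  refine mul_le_mul_of_nonneg_left ?_ (by positivity)
  exact (norm_sum_le _ _).trans
    (Finset.sum_le_sum fun v _ => norm_sum_momentWeight_sub_le h0 h1 h2 w v)

theorem trace_wordProd_rotate (A : Matrix V V ℂ) (a : Bool) (w : List Bool) :
    (wordProd A (a :: w)).trace = (wordProd A (w ++ [a])).trace := by
  simp only [wordProd, List.map_cons, List.prod_cons, List.map_append, List.prod_append,
    List.map_nil, List.prod_nil, mul_one]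
  rw [Matrix.trace_mul_comm]

theorem wordProd_append (A : Matrix V V ℂ) (w w' : List Bool) :
    wordProd A (w ++ w') = wordProd A w * wordProd A w' := by
  simp [wordProd]

end

/-! ### The limits of the expected spectral moments. -/

theorem zigzag_add_mul (m i q : ℕ) : zigzag m (i + 2 * m * q) = zigzag m i := by
  simp [zigzag, Nat.add_mul_mod_self_left]

theorem window_zigzag_period (m : ℕ) :
    window (zigzag m) 0 (2 * m) = List.replicate m true ++ List.replicate m false := by
  have hconst : ∀ (b : Bool) (i n : ℕ), window (fun _ => b) i n = List.replicate n b := by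
    intro b i n
    induction n generalizing i with
    | zero => rfl
    | succ n ih => rw [window, ih, List.replicate_succ]
  rw [two_mul, window_add, zero_add]
  congr 1
  · rw [← hconst true 0 m]
    refine window_congr fun k hk => ?_
    simp only [zigzag, zero_add, decide_eq_true_eq]
    rwa [Nat.mod_eq_of_lt (by omega)]
  · rw [← hconst false 0 m]
    refine window_congr fun k hk => ?_
    simp only [zigzag, decide_eq_false_iff_not]
    rw [Nat.mod_eq_of_lt (by omega)]
    omega

theorem wordProd_zigzag {N : ℕ} (m p : ℕ) (A : Matrix (Fin N) (Fin N) ℂ) :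
    wordProd A (window (zigzag m) 0 (2 * m * p)) = powerGram m A ^ p := by
  induction p with
  | zero => simp [window, wordProd]
  | succ p ih =>
    rw [Nat.mul_succ, Nat.add_comm, window_add, wordProd_append, pow_succ', zero_add]
    congr 1
    · rw [window_zigzag_period]
      simp [wordProd, powerGram]
    · rw [← ih]
      congr 1
      refine window_congr fun k _ => ?_
      have := zigzag_add_mul m k 1
      rw [mul_one] at this
      rw [zero_add, add_comm, this]

section
variable {Ω₀ Ω : Type*} [MeasurableSpace Ω₀] [MeasurableSpace Ω] {P₀ : Measure Ω₀} {P : Measure Ω}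

/-- The scaling by `N^(-1/2)` is part of `g N`. Among the moments of order two only `M 1 1` needs a
limit; the others need only be at most `1/N`. -/
theorem tendsto_trace_wordProd [IsFiniteMeasure P] {x : Ω₀ → ℂ} {X : (N : ℕ) → Fin N → Fin N → Ω → ℂ}
    (hX : ∀ (N : ℕ) (i j : Fin N), IdentDistrib (X N i j) x P P₀)
    (hindep : ∀ N : ℕ, iIndepFun (fun ij : Fin N × Fin N => X N ij.1 ij.2) P)
    {g : ℕ → ℂ → ℂ} (hg : ∀ N, Measurable (g N)) {C : ℕ → ℝ} (hC : ∀ N z, ‖g N z‖ ≤ C N)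
    {η : ℕ → ℝ} (hη : Tendsto η atTop (𝓝 0))
    (h0 : ∀ N, mixedMoment P₀ x (g N) 0 0 = 1)
    (h1 : ∀ᶠ N : ℕ in atTop, ∀ a b, a + b ≠ 0 → ‖mixedMoment P₀ x (g N) a b‖ ≤ (N : ℝ)⁻¹)
    (h2 : ∀ᶠ N : ℕ in atTop, ∀ a b, a + b ≠ 0 → a + b ≠ 2 →
      ‖mixedMoment P₀ x (g N) a b‖ ≤ (N : ℝ)⁻¹ * η N)
    (h11 : Tendsto (fun N : ℕ => (N : ℂ) * mixedMoment P₀ x (g N) 1 1) atTop (𝓝 1))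
    (w : List Bool) :
    Tendsto (fun N : ℕ => (N : ℂ)⁻¹ *
      ∫ ω, (wordProd (Matrix.of fun i j => g N (X N i j ω)) w).trace ∂P) atTop
      (𝓝 (stackCount w [] : ℂ)) := by
  have hA : Tendsto (fun N : ℕ => ((N : ℂ) * mixedMoment P₀ x (g N) 1 1) ^ (w.length / 2) *
        (stackWeight N w [] 1 : ℝ)) atTop (𝓝 (stackCount w [] : ℂ)) := by
    have h3 := (h11.pow (w.length / 2)).mul
      ((Complex.continuous_ofReal.tendsto _).comp (tendsto_stackWeight w [] 1))
    simpa using h3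
  have hB : Tendsto (fun N : ℕ => max (η N) ((N : ℝ)⁻¹) * ((w.length + 2 : ℕ) : ℝ) ^ w.length)
      atTop (𝓝 0) := by
    have h3 := (hη.max tendsto_inv_atTop_nhds_zero_nat).mul_const
      (((w.length + 2 : ℕ) : ℝ) ^ w.length)
    simpa using h3
  refine hA.congr_dist ?_
  refine squeeze_zero' (Eventually.of_forall fun _ => dist_nonneg) ?_ hB
  filter_upwards [h1, h2, eventually_gt_atTop 0] with N hN1 hN2 hN
  have : Nonempty (Fin N) := ⟨⟨0, hN⟩⟩
  rw [dist_comm, dist_eq_norm]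
  have := norm_integral_trace_sub_le (V := Fin N) (fun e => hX N e.1 e.2) (hindep N) (hg N) (hC N)
    (h0 N) (by simpa using hN1) (by simpa using hN2) w
  simpa using this

theorem tendsto_trace_powerGram [IsFiniteMeasure P] {x : Ω₀ → ℂ}
    {X : (N : ℕ) → Fin N → Fin N → Ω → ℂ}
    (hX : ∀ (N : ℕ) (i j : Fin N), IdentDistrib (X N i j) x P P₀)
    (hindep : ∀ N : ℕ, iIndepFun (fun ij : Fin N × Fin N => X N ij.1 ij.2) P)
    {g : ℕ → ℂ → ℂ} (hg : ∀ N, Measurable (g N)) {C : ℕ → ℝ} (hC : ∀ N z, ‖g N z‖ ≤ C N)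
    {η : ℕ → ℝ} (hη : Tendsto η atTop (𝓝 0))
    (h0 : ∀ N, mixedMoment P₀ x (g N) 0 0 = 1)
    (h1 : ∀ᶠ N : ℕ in atTop, ∀ a b, a + b ≠ 0 → ‖mixedMoment P₀ x (g N) a b‖ ≤ (N : ℝ)⁻¹)
    (h2 : ∀ᶠ N : ℕ in atTop, ∀ a b, a + b ≠ 0 → a + b ≠ 2 →
      ‖mixedMoment P₀ x (g N) a b‖ ≤ (N : ℝ)⁻¹ * η N)
    (h11 : Tendsto (fun N : ℕ => (N : ℂ) * mixedMoment P₀ x (g N) 1 1) atTop (𝓝 1))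
    {m : ℕ} (hm : 1 ≤ m) (p : ℕ) :
    Tendsto (fun N : ℕ => (N : ℂ)⁻¹ *
      ∫ ω, (powerGram m (Matrix.of fun i j => g N (X N i j ω)) ^ p).trace ∂P) atTop
      (𝓝 ((1 / ((m : ℝ) * p + 1) * ((m * p + p).choose p : ℝ) : ℝ) : ℂ)) := by
  have hlim := tendsto_trace_wordProd hX hindep hg hC hη h0 h1 h2 h11
  -- Rotating a word does not change its trace, so both counts are the limit of one sequence. This
  -- replaces a combinatorial proof of cyclic invariance.
  have hrot : ∀ (a : Bool) (w : List Bool), stackCount (a :: w) [] = stackCount (w ++ [a]) [] := by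
    intro a w
    have h3 := hlim (a :: w)
    simp only [trace_wordProd_rotate] at h3
    exact_mod_cast tendsto_nhds_unique h3 (hlim (w ++ [a]))
  have hc : ∀ i q, stackCount (window (zigzag m) i (2 * m * q)) [] =
      stackCount (window (zigzag m) 0 (2 * m * q)) [] := by
    intro i q
    induction i with
    | zero => rfl
    | succ i ih =>
      rw [← ih]
      rcases Nat.eq_zero_or_pos (2 * m * q) with h | h
      · rw [h]; rfl
      · obtain ⟨n, hn⟩ := Nat.exists_eq_add_of_lt h
        rw [zero_add] at hn
        have hz := zigzag_add_mul m i q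
        rw [hn] at hz ⊢
        -- The first letter, moved to the end, is the letter at `i + 2mq` by periodicity, so
        -- rotating the window shifts it by one.
        have h5 : window (zigzag m) i (n + 1) = zigzag m i :: window (zigzag m) (i + 1) n := rfl
        rw [h5, hrot, window_add]
        simp only [window]
        rw [show i + 1 + n = i + (n + 1) by omega, hz]
  have hval := stackCount_zigzag hm _ hc p
  have h3 := hlim (window (zigzag m) 0 (2 * m * p))
  simp only [wordProd_zigzag] at h3
  have h4 : ((stackCount (window (zigzag m) 0 (2 * m * p)) [] : ℕ) : ℝ) =
      1 / ((m : ℝ) * p + 1) * ((m * p + p).choose p : ℝ) := by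
    have := congrArg (fun t : ℚ => (t : ℝ)) hval
    push_cast at this
    exact this
  rw [← h4, Complex.ofReal_natCast]
  exact h3

end

/-! ### Truncation of the entries. -/

section
variable {Ω₀ : Type*} [MeasurableSpace Ω₀] {P₀ : Measure Ω₀} {x : Ω₀ → ℂ}

/-- The part of the fourth absolute moment outside of the disc of radius `r`. -/
noncomputable def fourthTail (P₀ : Measure Ω₀) (x : Ω₀ → ℂ) (r : ℝ) : ℝ :=
  ∫ ω, (if ‖x ω‖ ≤ r then 0 else ‖x ω‖ ^ 4) ∂P₀

theorem integrable_ite_norm_le (hx : AEMeasurable x P₀) {f : ℂ → ℝ} (hf : Measurable f)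
    (hint : Integrable (fun ω => f (x ω)) P₀) (r : ℝ) :
    Integrable (fun ω => if ‖x ω‖ ≤ r then 0 else f (x ω)) P₀ := by
  refine hint.mono ?_ (ae_of_all _ fun ω => ?_)
  · have : Measurable fun z : ℂ => if ‖z‖ ≤ r then 0 else f z :=
      Measurable.ite (measurableSet_le measurable_norm measurable_const) measurable_const hf
    exact (this.comp_aemeasurable hx).aestronglyMeasurable
  · split_ifs <;> simp

theorem fourthTail_nonneg (r : ℝ) : 0 ≤ fourthTail P₀ x r :=
  integral_nonneg fun ω => by
    simp only [Pi.zero_apply]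
    split_ifs <;> positivity

theorem fourthTail_anti (hx : AEMeasurable x P₀) (hx_four : Integrable (fun ω => ‖x ω‖ ^ 4) P₀)
    {r r' : ℝ} (h : r ≤ r') : fourthTail P₀ x r' ≤ fourthTail P₀ x r := by
  have hf : Measurable fun z : ℂ => ‖z‖ ^ 4 := measurable_norm.pow_const _
  refine integral_mono (integrable_ite_norm_le hx hf hx_four _)
    (integrable_ite_norm_le hx hf hx_four _) fun ω => ?_
  simp only
  split_ifs with h1 h2
  · rfl
  · positivity
  · linarith
  · rfl

theorem tendsto_fourthTail (hx : AEMeasurable x P₀)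
    (hx_four : Integrable (fun ω => ‖x ω‖ ^ 4) P₀) {r : ℕ → ℝ} (hr : Tendsto r atTop atTop) :
    Tendsto (fun N => fourthTail P₀ x (r N)) atTop (𝓝 0) := by
  have hf : Measurable fun z : ℂ => ‖z‖ ^ 4 := measurable_norm.pow_const _
  have h0 : (0 : ℝ) = ∫ _, (0 : ℝ) ∂P₀ := by simp
  rw [h0]
  refine tendsto_integral_of_dominated_convergence (fun ω => ‖x ω‖ ^ 4)
    (fun N => (integrable_ite_norm_le hx hf hx_four _).aestronglyMeasurable) hx_four
    (fun N => ae_of_all _ fun ω => ?_) (ae_of_all _ fun ω => ?_)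
  · split_ifs <;> simp
  · refine tendsto_const_nhds.congr' ?_
    filter_upwards [hr.eventually_ge_atTop ‖x ω‖] with N hN
    rw [if_pos hN]

/-- Truncation levels that go to zero, but slowly. -/
theorem exists_truncation_level (hx : AEMeasurable x P₀)
    (hx_four : Integrable (fun ω => ‖x ω‖ ^ 4) P₀) :
    ∃ δ : ℕ → ℝ, Tendsto δ atTop (𝓝 0) ∧ (∀ N, 0 ≤ δ N) ∧
      Tendsto (fun N : ℕ => δ N * √N) atTop atTop ∧
      ∀ N : ℕ, 0 < N → 0 < δ N ∧ fourthTail P₀ x (δ N * √N) ≤ δ N ^ 8 := by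
  set r : ℕ → ℝ := fun N => √(√N) with hr
  have hr1 : Tendsto r atTop atTop :=
    Real.tendsto_sqrt_atTop.comp (Real.tendsto_sqrt_atTop.comp tendsto_natCast_atTop_atTop)
  have hτ := tendsto_fourthTail hx hx_four hr1
  -- With `r = N^(1/4)`, the tail beyond `r` is exactly `s ^ 8`. Any exponent above 4 would serve:
  -- the bound on the truncated mean loses `δ ^ 3` and the union bound loses `δ ^ 4`.
  set s : ℕ → ℝ := fun N => √(√(√(fourthTail P₀ x (r N)))) with hs
  have hs0 : Tendsto s atTop (𝓝 0) := by
    have := ((hτ.sqrt).sqrt).sqrt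
    simpa using this
  have hs8 : ∀ N, fourthTail P₀ x (r N) = s N ^ 8 := by
    intro N
    rw [hs, show (8 : ℕ) = 2 * (2 * 2) by norm_num, pow_mul, pow_mul,
      Real.sq_sqrt (Real.sqrt_nonneg _), Real.sq_sqrt (Real.sqrt_nonneg _),
      Real.sq_sqrt (fourthTail_nonneg _)]
  have hsn : ∀ N, 0 ≤ s N := fun N => Real.sqrt_nonneg _
  have hrn : ∀ N, 0 ≤ r N := fun N => Real.sqrt_nonneg _
  have hge : ∀ N : ℕ, r N ≤ max (s N) ((r N)⁻¹) * √N := by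
    intro N
    have h1 : (r N) * (r N) = √N := Real.mul_self_sqrt (Real.sqrt_nonneg _)
    rcases (hrn N).eq_or_lt with h | h
    · rw [← h]
      exact mul_nonneg (le_max_of_le_left (hsn N)) (Real.sqrt_nonneg _)
    · calc r N = (r N)⁻¹ * √N := by rw [← h1]; field_simp
        _ ≤ _ := mul_le_mul_of_nonneg_right (le_max_right _ _) (Real.sqrt_nonneg _)
  -- The term `r⁻¹` keeps `δ` positive for `N > 0` and gives `δ √N ≥ r`, so the tail beyond `δ √N`
  -- is at most the tail beyond `r`.
  refine ⟨fun N => max (s N) ((r N)⁻¹), ?_, ?_, ?_, ?_⟩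
  · have := hs0.max (tendsto_inv_atTop_zero.comp hr1)
    simpa using this
  · exact fun N => le_max_of_le_left (hsn N)
  · exact tendsto_atTop_mono hge hr1
  · intro N hN
    have hrpos : 0 < r N := Real.sqrt_pos.mpr (Real.sqrt_pos.mpr (by exact_mod_cast hN))
    refine ⟨lt_max_of_lt_right (inv_pos.mpr hrpos), ?_⟩
    calc _ ≤ fourthTail P₀ x (r N) := fourthTail_anti hx hx_four (hge N)
      _ = s N ^ 8 := hs8 N
      _ ≤ _ := pow_le_pow_left₀ (hsn N) (le_max_left _ _) 8

/-- Truncation at radius `r`, followed by division by the square root of `N`. -/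
noncomputable def truncScale (N : ℕ) (r : ℝ) (z : ℂ) : ℂ :=
  ((√N : ℝ) : ℂ)⁻¹ * if ‖z‖ ≤ r then z else 0

theorem measurable_truncScale (N : ℕ) (r : ℝ) : Measurable (truncScale N r) :=
  measurable_const.mul
    (Measurable.ite (measurableSet_le measurable_norm measurable_const) measurable_id
      measurable_const)

theorem norm_truncScale_le (N : ℕ) {r : ℝ} (hr : 0 ≤ r) (z : ℂ) :
    ‖truncScale N r z‖ ≤ (√N)⁻¹ * r := by
  rw [truncScale, norm_mul, norm_inv, Complex.norm_real, Real.norm_of_nonneg (Real.sqrt_nonneg _)]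
  refine mul_le_mul_of_nonneg_left ?_ (by positivity)
  split_ifs with h
  · exact h
  · simpa using hr

theorem norm_truncScale_sq (N : ℕ) (r : ℝ) (z : ℂ) :
    ‖truncScale N r z‖ ^ 2 = (N : ℝ)⁻¹ * if ‖z‖ ≤ r then ‖z‖ ^ 2 else 0 := by
  rw [truncScale, norm_mul, norm_inv, Complex.norm_real, Real.norm_of_nonneg (Real.sqrt_nonneg _),
    mul_pow, inv_pow, Real.sq_sqrt (Nat.cast_nonneg N)]
  split_ifs <;> simp

theorem integrable_truncScale_pow [IsFiniteMeasure P₀] (hx : AEMeasurable x P₀) (N : ℕ) {r : ℝ}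
    (hr : 0 ≤ r) (n : ℕ) : Integrable (fun ω => ‖truncScale N r (x ω)‖ ^ n) P₀ := by
  refine Integrable.of_bound
    (((measurable_truncScale N r).norm.pow_const n).comp_aemeasurable hx).aestronglyMeasurable
    (((√N)⁻¹ * r) ^ n) (ae_of_all _ fun ω => ?_)
  simp only [norm_pow, norm_norm]
  exact pow_le_pow_left₀ (norm_nonneg _) (norm_truncScale_le N hr _) n

theorem integral_truncScale_sq_le [IsFiniteMeasure P₀] (hx : AEMeasurable x P₀)
    (hx2 : Integrable (fun ω => ‖x ω‖ ^ 2) P₀) (hx_var : ∫ ω, ‖x ω‖ ^ 2 ∂P₀ = 1) (N : ℕ) {r : ℝ}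
    (hr : 0 ≤ r) : ∫ ω, ‖truncScale N r (x ω)‖ ^ 2 ∂P₀ ≤ (N : ℝ)⁻¹ := by
  calc _ ≤ ∫ ω, (N : ℝ)⁻¹ * ‖x ω‖ ^ 2 ∂P₀ := by
        refine integral_mono (integrable_truncScale_pow hx N hr 2) (hx2.const_mul _) fun ω => ?_
        simp only
        rw [norm_truncScale_sq]
        refine mul_le_mul_of_nonneg_left ?_ (by positivity)
        split_ifs
        · rfl
        · positivity
    _ = _ := by rw [integral_const_mul, hx_var, mul_one]

theorem norm_mixedMoment_le (g : ℂ → ℂ) (a b : ℕ) :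
    ‖mixedMoment P₀ x g a b‖ ≤ ∫ ω, ‖g (x ω)‖ ^ (a + b) ∂P₀ := by
  refine (norm_integral_le_integral_norm _).trans_eq ?_
  simp only [norm_mul, norm_pow, norm_star, pow_add]

/-- The truncated scaled variable is bounded by `δ ≤ 1`, so each moment of order at least three is
at most `δ` times the second. -/
theorem integral_truncScale_pow_le [IsFiniteMeasure P₀] (hx : AEMeasurable x P₀)
    (hx2 : Integrable (fun ω => ‖x ω‖ ^ 2) P₀) (hx_var : ∫ ω, ‖x ω‖ ^ 2 ∂P₀ = 1) (N : ℕ) {δ : ℝ}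
    (hδ : 0 ≤ δ) (hδ1 : δ ≤ 1) (n : ℕ) :
    ∫ ω, ‖truncScale N (δ * √N) (x ω)‖ ^ (n + 3) ∂P₀ ≤ (N : ℝ)⁻¹ * δ := by
  have hr : 0 ≤ δ * √N := by positivity
  have hle : ∀ z, ‖truncScale N (δ * √N) z‖ ≤ δ := by
    intro z
    refine (norm_truncScale_le N hr z).trans ?_
    rw [mul_left_comm]
    exact mul_le_of_le_one_right hδ inv_mul_le_one
  calc _ ≤ ∫ ω, δ * ‖truncScale N (δ * √N) (x ω)‖ ^ 2 ∂P₀ := by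
        refine integral_mono (integrable_truncScale_pow hx N hr _)
          ((integrable_truncScale_pow hx N hr 2).const_mul _) fun ω => ?_
        simp only
        rw [show n + 3 = (n + 1) + 2 by omega, pow_add]
        refine mul_le_mul_of_nonneg_right ?_ (by positivity)
        rw [pow_succ]
        have h1 := hle (x ω)
        have h2 : ‖truncScale N (δ * √N) (x ω)‖ ^ n ≤ 1 :=
          pow_le_one₀ (norm_nonneg _) (h1.trans hδ1)
        calc _ ≤ 1 * δ := mul_le_mul h2 h1 (norm_nonneg _) zero_le_one
          _ = δ := one_mul δ
    _ = δ * ∫ ω, ‖truncScale N (δ * √N) (x ω)‖ ^ 2 ∂P₀ := integral_const_mul _ _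
    _ ≤ δ * (N : ℝ)⁻¹ :=
        mul_le_mul_of_nonneg_left (integral_truncScale_sq_le hx hx2 hx_var N hr) hδ
    _ = _ := mul_comm _ _

/-- As `x` is centred, the truncated mean is minus the mean of the tail, where `‖x‖ ≤ r⁻³ ‖x‖⁴`. It
is small enough that no recentring is needed. -/
theorem norm_integral_truncScale_le (hx : AEMeasurable x P₀) (hx1 : Integrable x P₀)
    (hx_mean : ∫ ω, x ω ∂P₀ = 0)
    (hx_four : Integrable (fun ω => ‖x ω‖ ^ 4) P₀) {N : ℕ} (hN : 0 < N) {δ : ℝ}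
    (hδ : 0 < δ) (hδ1 : δ ≤ 1) (hτ : fourthTail P₀ x (δ * √N) ≤ δ ^ 8) :
    ‖∫ ω, truncScale N (δ * √N) (x ω) ∂P₀‖ ≤ (N : ℝ)⁻¹ * δ := by
  have hN1 : (1 : ℝ) ≤ N := by exact_mod_cast hN
  have hs1 : 1 ≤ √(N : ℝ) := Real.one_le_sqrt.mpr hN1
  set r := δ * √(N : ℝ) with hr
  have hrpos : 0 < r := by positivity
  have hcompl : ∫ ω, truncScale N r (x ω) ∂P₀ =
      -(((√N : ℝ) : ℂ)⁻¹ * ∫ ω, (if ‖x ω‖ ≤ r then 0 else x ω) ∂P₀) := by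
    have hi : Integrable (fun ω => if ‖x ω‖ ≤ r then 0 else x ω) P₀ := by
      refine hx1.mono ?_ (ae_of_all _ fun ω => by split_ifs <;> simp)
      have : Measurable fun z : ℂ => if ‖z‖ ≤ r then 0 else z :=
        Measurable.ite (measurableSet_le measurable_norm measurable_const) measurable_const
          measurable_id
      exact (this.comp_aemeasurable hx).aestronglyMeasurable
    have h1 : ∀ ω, truncScale N r (x ω) =
        ((√N : ℝ) : ℂ)⁻¹ * (x ω - if ‖x ω‖ ≤ r then 0 else x ω) := by
      intro ω
      rw [truncScale]
      split_ifs <;> simp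
    simp only [h1]
    rw [integral_const_mul, integral_sub hx1 hi, hx_mean, zero_sub, mul_neg]
  rw [hcompl, norm_neg, norm_mul, norm_inv, Complex.norm_real,
    Real.norm_of_nonneg (Real.sqrt_nonneg _)]
  have h2 : ‖∫ ω, (if ‖x ω‖ ≤ r then 0 else x ω) ∂P₀‖ ≤ (r ^ 3)⁻¹ * fourthTail P₀ x r := by
    rw [fourthTail, ← integral_const_mul]
    refine norm_integral_le_of_norm_le ((integrable_ite_norm_le hx
      (measurable_norm.pow_const 4) hx_four r).const_mul _) (ae_of_all _ fun ω => ?_)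
    split_ifs with h
    · simp
    · push Not at h
      have h3 : r ^ 3 ≤ ‖x ω‖ ^ 3 := pow_le_pow_left₀ hrpos.le h.le 3
      rw [inv_mul_eq_div, le_div_iff₀ (by positivity)]
      calc ‖x ω‖ * r ^ 3 ≤ ‖x ω‖ * ‖x ω‖ ^ 3 := mul_le_mul_of_nonneg_left h3 (norm_nonneg _)
        _ = _ := by ring
  have h4 : (r ^ 3)⁻¹ * fourthTail P₀ x r ≤ (r ^ 3)⁻¹ * δ ^ 8 :=
    mul_le_mul_of_nonneg_left hτ (by positivity)
  have h5 : (r ^ 3)⁻¹ * δ ^ 8 = δ ^ 5 * (√(N : ℝ))⁻¹ ^ 3 := by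
    rw [hr]; field_simp
  have h6 : δ ^ 5 ≤ δ := by
    have := pow_le_pow_of_le_one hδ.le hδ1 (show 1 ≤ 5 by norm_num)
    simpa using this
  have h7 : (√(N : ℝ))⁻¹ ^ 3 ≤ (√(N : ℝ))⁻¹ := by
    have := pow_le_pow_of_le_one (a := (√(N : ℝ))⁻¹) (by positivity)
      (inv_le_one_of_one_le₀ hs1) (show 1 ≤ 3 by norm_num)
    simpa using this
  have h8 : (√(N : ℝ))⁻¹ * (√(N : ℝ))⁻¹ = (N : ℝ)⁻¹ := by
    rw [← mul_inv, Real.mul_self_sqrt (Nat.cast_nonneg N)]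
  calc _ ≤ (√(N : ℝ))⁻¹ * (δ * (√(N : ℝ))⁻¹) := by
        refine mul_le_mul_of_nonneg_left (h2.trans (h4.trans ?_)) (by positivity)
        rw [h5]
        exact mul_le_mul h6 h7 (by positivity) hδ.le
    _ = (N : ℝ)⁻¹ * δ := by rw [← h8]; ring

theorem measureReal_norm_gt_le [IsFiniteMeasure P₀] (hx : AEMeasurable x P₀)
    (hx_four : Integrable (fun ω => ‖x ω‖ ^ 4) P₀) {r : ℝ} (hr : 0 < r) :
    P₀.real {ω | r < ‖x ω‖} ≤ fourthTail P₀ x r / r ^ 4 := by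
  rw [le_div_iff₀ (by positivity)]
  have hm : NullMeasurableSet {ω | r < ‖x ω‖} P₀ :=
    hx.nullMeasurable (measurableSet_lt measurable_const measurable_norm)
  have h1 : P₀.real {ω | r < ‖x ω‖} * r ^ 4 =
      ∫ ω, Set.indicator {ω | r < ‖x ω‖} (fun _ => r ^ 4) ω ∂P₀ := by
    rw [integral_indicator₀ hm, setIntegral_const, smul_eq_mul]
  rw [h1, fourthTail]
  refine integral_mono ((integrable_const _).indicator₀ hm)
    (integrable_ite_norm_le hx (measurable_norm.pow_const 4) hx_four r) fun ω => ?_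
  simp only [Set.indicator, Set.mem_ofPred_eq]
  split_ifs with h1 h2 h2
  · linarith
  · exact pow_le_pow_left₀ hr.le h1.le 4
  · rfl
  · positivity

/-- Truncation functions under which the mixed moments satisfy the hypotheses of the moment method
and that change the entries with small probability. -/
theorem exists_truncation [IsProbabilityMeasure P₀] (hx : AEMeasurable x P₀)
    (hx_mean : ∫ ω, x ω ∂P₀ = 0) (hx_var : ∫ ω, ‖x ω‖ ^ 2 ∂P₀ = 1)
    (hx_four : Integrable (fun ω => ‖x ω‖ ^ 4) P₀) :
    ∃ (g : ℕ → ℂ → ℂ) (C η : ℕ → ℝ) (r : ℕ → ℝ), (∀ N, Measurable (g N)) ∧ (∀ N z, ‖g N z‖ ≤ C N) ∧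
      Tendsto η atTop (𝓝 0) ∧ (∀ N, mixedMoment P₀ x (g N) 0 0 = 1) ∧
      (∀ᶠ N : ℕ in atTop, ∀ a b, a + b ≠ 0 → ‖mixedMoment P₀ x (g N) a b‖ ≤ (N : ℝ)⁻¹) ∧
      (∀ᶠ N : ℕ in atTop, ∀ a b, a + b ≠ 0 → a + b ≠ 2 →
        ‖mixedMoment P₀ x (g N) a b‖ ≤ (N : ℝ)⁻¹ * η N) ∧
      Tendsto (fun N : ℕ => (N : ℂ) * mixedMoment P₀ x (g N) 1 1) atTop (𝓝 1) ∧
      (∀ N z, ‖z‖ ≤ r N → g N z = ((√N : ℝ) : ℂ)⁻¹ * z) ∧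
      Tendsto (fun N : ℕ => (N : ℝ) ^ 2 * P₀.real {ω | r N < ‖x ω‖}) atTop (𝓝 0) := by
  obtain ⟨δ, hδ0, hδn, hδr, hδ⟩ := exists_truncation_level hx hx_four
  have hx2 : Integrable (fun ω => ‖x ω‖ ^ 2) P₀ := by
    -- A non-integrable function would have Bochner integral 0 rather than 1.
    by_contra h
    rw [integral_undef h] at hx_var
    exact zero_ne_one hx_var
  have hx1 : Integrable x P₀ := by
    refine ((integrable_const (1 : ℝ)).add hx2).mono hx.aestronglyMeasurable
      (ae_of_all _ fun ω => ?_)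
    rw [Real.norm_of_nonneg (by simp only [Pi.add_apply]; positivity)]
    simp only [Pi.add_apply]
    nlinarith [sq_nonneg (‖x ω‖ - 1)]
  have hrn : ∀ N : ℕ, 0 ≤ δ N * √N := fun N => mul_nonneg (hδn N) (Real.sqrt_nonneg _)
  have hsmall : ∀ᶠ N : ℕ in atTop, ∀ a b, a + b ≠ 0 → a + b ≠ 2 →
      ‖mixedMoment P₀ x (truncScale N (δ N * √N)) a b‖ ≤ (N : ℝ)⁻¹ * δ N := by
    filter_upwards [eventually_gt_atTop 0, hδ0.eventually_le_const zero_lt_one] with N hN hN1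
    intro a b hab0 hab2
    by_cases hab1 : a + b = 1
    · have h1 := norm_integral_truncScale_le hx hx1 hx_mean hx_four hN (hδ N hN).1 hN1 (hδ N hN).2
      rcases Nat.eq_zero_or_pos a with ha | ha
      · obtain rfl : b = 1 := by omega
        subst ha
        simp only [mixedMoment, pow_zero, pow_one, one_mul]
        have : ∫ ω, star (truncScale N (δ N * √N) (x ω)) ∂P₀ =
            star (∫ ω, truncScale N (δ N * √N) (x ω) ∂P₀) := integral_conj
        rw [this, norm_star]
        exact h1
      · obtain rfl : b = 0 := by omega
        obtain rfl : a = 1 := by omega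
        simpa [mixedMoment] using h1
    · obtain ⟨n, hn⟩ := Nat.exists_eq_add_of_le (show 3 ≤ a + b by omega)
      refine (norm_mixedMoment_le _ _ _).trans ?_
      rw [hn, add_comm]
      exact integral_truncScale_pow_le hx hx2 hx_var N (hδn N) hN1 n
  refine ⟨fun N => truncScale N (δ N * √N), fun N => (√N)⁻¹ * (δ N * √N), δ,
    fun N => δ N * √N, fun N => measurable_truncScale _ _,
    fun N z => norm_truncScale_le N (hrn N) z, hδ0, ?_, ?_, hsmall, ?_, ?_, ?_⟩
  · intro N
    simp [mixedMoment]
  · filter_upwards [hsmall, hδ0.eventually_le_const zero_lt_one] with N hN hN1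
    intro a b hab0
    by_cases hab2 : a + b = 2
    · refine (norm_mixedMoment_le _ _ _).trans ?_
      rw [hab2]
      exact integral_truncScale_sq_le hx hx2 hx_var N (hrn N)
    · exact (hN a b hab0 hab2).trans (mul_le_of_le_one_right (by positivity) hN1)
  · have h1 : Tendsto (fun N : ℕ => ∫ ω, (if ‖x ω‖ ≤ δ N * √N then ‖x ω‖ ^ 2 else 0) ∂P₀) atTop
        (𝓝 (∫ ω, ‖x ω‖ ^ 2 ∂P₀)) := by
      refine tendsto_integral_of_dominated_convergence (fun ω => ‖x ω‖ ^ 2) (fun N => ?_) hx2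
        (fun N => ae_of_all _ fun ω => ?_) (ae_of_all _ fun ω => ?_)
      · have : Measurable fun z : ℂ => if ‖z‖ ≤ δ N * √N then ‖z‖ ^ 2 else 0 :=
          Measurable.ite (measurableSet_le measurable_norm measurable_const)
            (measurable_norm.pow_const 2) measurable_const
        exact (this.comp_aemeasurable hx).aestronglyMeasurable
      · split_ifs <;> simp
      · refine tendsto_const_nhds.congr' ?_
        filter_upwards [hδr.eventually_ge_atTop ‖x ω‖] with N hN
        rw [if_pos hN]
    rw [hx_var] at h1
    have h2 := (Complex.continuous_ofReal.tendsto _).comp h1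
    rw [Complex.ofReal_one] at h2
    refine h2.congr' ?_
    filter_upwards [eventually_gt_atTop 0] with N hN
    have hN0 : (N : ℝ) ≠ 0 := by exact_mod_cast hN.ne'
    have h3 : mixedMoment P₀ x (truncScale N (δ N * √N)) 1 1 =
        ((∫ ω, ‖truncScale N (δ N * √N) (x ω)‖ ^ 2 ∂P₀ : ℝ) : ℂ) := by
      rw [mixedMoment, ← integral_complex_ofReal]
      refine integral_congr_ae (ae_of_all _ fun ω => ?_)
      simp only [pow_one, Complex.ofReal_pow]
      exact Complex.mul_conj' _
    rw [h3]
    simp only [norm_truncScale_sq]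
    rw [integral_const_mul, Function.comp]
    push_cast
    rw [← mul_assoc, mul_inv_cancel₀ (by exact_mod_cast hN.ne'), one_mul]
  · intro N z hz
    have hz' : ‖z‖ ≤ δ N * √N := hz
    simp only [truncScale, if_pos hz']
  -- Markov's inequality gives `N² · δ⁸ / (δ √N)⁴ = δ⁴ → 0`; this is where the finite fourth moment
  -- is essential.
  · have h4 : Tendsto (fun N => δ N ^ 4) atTop (𝓝 0) := by
      simpa using hδ0.pow 4
    refine squeeze_zero' (Eventually.of_forall fun N => by positivity) ?_ h4
    filter_upwards [eventually_gt_atTop 0] with N hN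
    obtain ⟨hpos, hτ⟩ := hδ N hN
    have hNpos : (0 : ℝ) < N := by exact_mod_cast hN
    have h5 := measureReal_norm_gt_le hx hx_four (show 0 < δ N * √N by positivity)
    have h6 : (√(N : ℝ)) ^ 4 = (N : ℝ) ^ 2 := by
      rw [show (4 : ℕ) = 2 * 2 by norm_num, pow_mul, Real.sq_sqrt hNpos.le]
    calc (N : ℝ) ^ 2 * P₀.real {ω | δ N * √N < ‖x ω‖}
        ≤ (N : ℝ) ^ 2 * (δ N ^ 8 / (δ N * √N) ^ 4) := by
          refine mul_le_mul_of_nonneg_left (h5.trans ?_) (by positivity)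
          gcongr
      _ = δ N ^ 4 := by
          rw [mul_pow, h6]; field_simp

end

/-! ### The Fuss–Catalan law as a product of beta variables. -/

/-- Weighting by `y ^ p` only shifts the first parameter, so the moments are quotients of beta
functions. -/
theorem betaPDFReal_mul_pow {a b : ℝ} (ha : 0 < a) (hb : 0 < b) (p : ℕ) (y : ℝ) :
    betaPDFReal a b y * y ^ p = beta (a + p) b / beta a b * betaPDFReal (a + p) b y := by
  rw [betaPDFReal, betaPDFReal]
  split_ifs with h
  · have h1 : y ^ (a + p - 1) = y ^ (a - 1) * y ^ p := by
      rw [← Real.rpow_add_natCast h.1.ne']; ring_nf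
    have h2 := (beta_pos ha hb).ne'
    have h3 := (beta_pos (show 0 < a + p by positivity) hb).ne'
    rw [h1]
    field_simp
  · simp

theorem betaPDFReal_nonneg {a b : ℝ} (ha : 0 < a) (hb : 0 < b) (y : ℝ) : 0 ≤ betaPDFReal a b y := by
  by_cases h : 0 < y ∧ y < 1
  · exact (betaPDFReal_pos h.1 h.2 ha hb).le
  · rw [betaPDFReal, if_neg h]

theorem integral_betaPDFReal {a b : ℝ} (ha : 0 < a) (hb : 0 < b) : ∫ y, betaPDFReal a b y = 1 := by
  rw [integral_eq_lintegral_of_nonneg_ae (ae_of_all _ (betaPDFReal_nonneg ha hb))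
    (measurable_betaPDFReal a b).aestronglyMeasurable]
  have := lintegral_betaPDF_eq_one ha hb
  simp only [betaPDF] at this
  rw [this, ENNReal.toReal_one]

theorem integral_betaMeasure_pow {a b : ℝ} (ha : 0 < a) (hb : 0 < b) (p : ℕ) :
    ∫ y, y ^ p ∂betaMeasure a b = beta (a + p) b / beta a b := by
  have hm : Measurable (betaPDF a b) := (measurable_betaPDFReal a b).ennreal_ofReal
  rw [betaMeasure, integral_withDensity_eq_integral_toReal_smul hm
    (ae_of_all _ fun _ => ENNReal.ofReal_lt_top)]
  have : ∀ y, (betaPDF a b y).toReal • y ^ p =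
      beta (a + p) b / beta a b * betaPDFReal (a + p) b y := by
    intro y
    rw [betaPDF, ENNReal.toReal_ofReal (betaPDFReal_nonneg ha hb y), smul_eq_mul,
      betaPDFReal_mul_pow ha hb]
  simp only [this]
  rw [integral_const_mul, integral_betaPDFReal (by positivity) hb, mul_one]

theorem beta_succ_div {a b : ℝ} (ha : 0 < a) (hb : 0 < b) :
    beta (a + 1) b = beta a b * (a / (a + b)) := by
  have h1 : Real.Gamma (a + b) ≠ 0 := (Real.Gamma_pos_of_pos (by positivity)).ne'
  have h2 : a + b ≠ 0 := by positivity
  rw [beta, beta, Real.Gamma_add_one ha.ne', show a + 1 + b = (a + b) + 1 by ring,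
    Real.Gamma_add_one h2]
  field_simp

theorem integral_betaMeasure_pow_succ {a b : ℝ} (ha : 0 < a) (hb : 0 < b) (p : ℕ) :
    ∫ y, y ^ (p + 1) ∂betaMeasure a b =
      (∫ y, y ^ p ∂betaMeasure a b) * ((a + p) / (a + p + b)) := by
  rw [integral_betaMeasure_pow ha hb, integral_betaMeasure_pow ha hb]
  push_cast
  rw [← add_assoc, beta_succ_div (by positivity) hb]
  ring

theorem ae_betaMeasure_mem {a b : ℝ} : ∀ᵐ y ∂betaMeasure a b, 0 < y ∧ y ≤ 1 := by
  have hm : Measurable (betaPDF a b) := (measurable_betaPDFReal a b).ennreal_ofReal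
  rw [betaMeasure, ae_withDensity_iff hm]
  refine ae_of_all _ fun y hy => ?_
  constructor
  · by_contra h
    exact hy (betaPDF_eq_zero_of_nonpos (not_lt.mp h))
  · by_contra h
    exact hy (betaPDF_eq_zero_of_one_le (not_le.mp h).le)

theorem betaMeasure_singleton {a b : ℝ} (t : ℝ) : betaMeasure a b {t} = 0 :=
  withDensity_absolutelyContinuous _ _ Real.volume_singleton

/-- The law of the product of `K` and of `n` independent beta variables. -/
noncomputable def prodBeta (K : ℝ) (a b : ℕ → ℝ) : ℕ → Measure ℝ
  | 0 => Measure.dirac K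
  | n + 1 => ((prodBeta K a b n).prod (betaMeasure (a n) (b n))).map fun q => q.1 * q.2

theorem measurable_fst_mul_snd : Measurable fun q : ℝ × ℝ => q.1 * q.2 := by fun_prop

section prodBeta
variable {K : ℝ} {a b : ℕ → ℝ}

theorem isProbabilityMeasure_prodBeta (ha : ∀ n, 0 < a n) (hb : ∀ n, 0 < b n) (n : ℕ) :
    IsProbabilityMeasure (prodBeta K a b n) := by
  induction n with
  | zero => rw [prodBeta]; infer_instance
  | succ n ih =>
    have := isProbabilityMeasureBeta (ha n) (hb n)
    exact Measure.isProbabilityMeasure_map measurable_fst_mul_snd.aemeasurable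

theorem ae_prodBeta_mem (hK : 0 < K) (ha : ∀ n, 0 < a n) (hb : ∀ n, 0 < b n) (n : ℕ) :
    ∀ᵐ s ∂prodBeta K a b n, 0 < s ∧ s ≤ K := by
  induction n with
  | zero =>
    rw [prodBeta, ae_dirac_iff (measurableSet_Ioc : MeasurableSet (Set.Ioc 0 K))]
    exact ⟨hK, le_rfl⟩
  | succ n ih =>
    have h1 := isProbabilityMeasureBeta (ha n) (hb n)
    have h2 := isProbabilityMeasure_prodBeta (K := K) ha hb n
    rw [prodBeta, ae_map_iff measurable_fst_mul_snd.aemeasurable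
      (measurableSet_Ioc : MeasurableSet (Set.Ioc 0 K))]
    have h3 := Measure.quasiMeasurePreserving_fst (μ := prodBeta K a b n)
      (ν := betaMeasure (a n) (b n)) |>.ae ih
    have h4 := Measure.quasiMeasurePreserving_snd (μ := prodBeta K a b n)
      (ν := betaMeasure (a n) (b n)) |>.ae (ae_betaMeasure_mem (a := a n) (b := b n))
    filter_upwards [h3, h4] with q hq1 hq2
    exact ⟨mul_pos hq1.1 hq2.1, (mul_le_of_le_one_right hq1.1.le hq2.2).trans hq1.2⟩

theorem integral_prodBeta_pow (ha : ∀ n, 0 < a n) (hb : ∀ n, 0 < b n) (n p : ℕ) :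
    ∫ s, s ^ p ∂prodBeta K a b n =
      K ^ p * ∏ j ∈ Finset.range n, ∫ y, y ^ p ∂betaMeasure (a j) (b j) := by
  induction n with
  | zero => simp [prodBeta]
  | succ n ih =>
    have h1 := isProbabilityMeasureBeta (ha n) (hb n)
    have h2 := isProbabilityMeasure_prodBeta (K := K) ha hb n
    rw [prodBeta, integral_map measurable_fst_mul_snd.aemeasurable
      (by fun_prop)]
    simp only [mul_pow]
    rw [integral_prod_mul (fun s : ℝ => s ^ p) (fun y : ℝ => y ^ p), ih, Finset.prod_range_succ,
      mul_assoc]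

/-- Given the earlier factors, whose product `s` is positive, the last beta variable would have to
equal `t / s`. At least one beta factor is needed, hence `n + 1`. -/
theorem prodBeta_singleton (hK : 0 < K) (ha : ∀ n, 0 < a n) (hb : ∀ n, 0 < b n) (n : ℕ) (t : ℝ) :
    prodBeta K a b (n + 1) {t} = 0 := by
  have h1 := isProbabilityMeasureBeta (ha n) (hb n)
  have h2 := isProbabilityMeasure_prodBeta (K := K) ha hb n
  rw [prodBeta, Measure.map_apply measurable_fst_mul_snd (measurableSet_singleton t),
    Measure.prod_apply (measurable_fst_mul_snd (measurableSet_singleton t)),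
    lintegral_eq_zero_iff' (measurable_measure_prodMk_left
      (measurable_fst_mul_snd (measurableSet_singleton t))).aemeasurable]
  filter_upwards [ae_prodBeta_mem hK ha hb n] with s hs
  refine measure_mono_null ?_ (betaMeasure_singleton (t / s))
  intro y hy
  have hy' : s * y = t := hy
  rw [Set.mem_singleton_iff, ← hy', mul_div_cancel_left₀ _ hs.1.ne']

end prodBeta

theorem fussCatalan_factorial (m p : ℕ) :
    1 / ((m : ℝ) * p + 1) * ((m * p + p).choose p : ℝ) * (m * p + 1).factorial * p.factorial =
      (m * p + p).factorial := by
  have h1 := Nat.add_choose_mul_factorial_mul_factorial (m * p) p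
  rw [← h1, Nat.factorial_succ]
  have : (m : ℝ) * p + 1 ≠ 0 := by positivity
  push_cast
  field_simp

/-- A probability measure with bounded support and without atoms whose moments are the
Fuss–Catalan numbers. -/
theorem exists_isFussCatalanLaw {m : ℕ} (hm : 1 ≤ m) :
    ∃ (G : Measure ℝ) (K : ℝ), 0 < K ∧ IsFussCatalanLaw m G ∧ (∀ᵐ s ∂G, |s| ≤ K) ∧
      ∀ t, G {t} = 0 := by
  have hm0 : (0 : ℝ) < m := by exact_mod_cast hm
  -- The ratio of consecutive Fuss–Catalan numbers is `(m + 1) ∏ ((m + 1)p + 1 + j) / ∏ (mp + 2 +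
  -- j)`, `j < m`. The beta moment ratio is `(a + p) / (a + b + p)`, so `a = (j + 1)/(m + 1)` and `a
  -- + b = (j + 2)/m`; `K` collects the constants.
  set K : ℝ := ((m : ℝ) + 1) * (((m : ℝ) + 1) / m) ^ m with hK
  set a : ℕ → ℝ := fun j => ((j : ℝ) + 1) / (m + 1) with ha
  set b : ℕ → ℝ := fun j => ((j : ℝ) + 2) / m - ((j : ℝ) + 1) / (m + 1) with hb
  have hK0 : 0 < K := by positivity
  have ha0 : ∀ j, 0 < a j := fun j => by simp only [ha]; positivity
  have hb0 : ∀ j, 0 < b j := by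
    intro j
    simp only [hb]
    rw [div_sub_div _ _ (by positivity) (by positivity)]
    apply div_pos _ (by positivity)
    have : (0 : ℝ) ≤ j := Nat.cast_nonneg j
    nlinarith
  have hprob := isProbabilityMeasure_prodBeta (K := K) ha0 hb0 m
  have hsupp : ∀ᵐ s ∂prodBeta K a b m, |s| ≤ K := by
    filter_upwards [ae_prodBeta_mem hK0 ha0 hb0 m] with s hs
    rw [abs_of_pos hs.1]; exact hs.2
  refine ⟨prodBeta K a b m, K, hK0, ⟨hprob, fun p => ?_, fun p => ?_⟩, hsupp, fun t => ?_⟩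
  · refine Integrable.of_bound (by fun_prop) (K ^ p) ?_
    filter_upwards [hsupp] with s hs
    rw [norm_pow, Real.norm_eq_abs]
    exact pow_le_pow_left₀ (abs_nonneg s) hs p
  · rw [integral_prodBeta_pow ha0 hb0]
    set f : ℕ → ℝ := fun p => K ^ p * ∏ j ∈ Finset.range m, ∫ y, y ^ p ∂betaMeasure (a j) (b j)
      with hf
    have hrec : ∀ p : ℕ, f (p + 1) * ∏ j ∈ Finset.range m, ((m : ℝ) * p + 2 + j) =
        f p * ((m + 1) * ∏ j ∈ Finset.range m, ((m : ℝ) * p + p + 1 + j)) := by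
      intro p
      simp only [hf, integral_betaMeasure_pow_succ (ha0 _) (hb0 _)]
      rw [Finset.prod_mul_distrib, pow_succ]
      have h1 : (∏ j ∈ Finset.range m, (a j + p) / (a j + p + b j)) *
          ∏ j ∈ Finset.range m, ((m : ℝ) * p + 2 + j) =
          ((m : ℝ) / (m + 1)) ^ m * ∏ j ∈ Finset.range m, ((m : ℝ) * p + p + 1 + j) := by
        rw [← Finset.prod_mul_distrib, ← Finset.card_range m, ← Finset.prod_const,
          Finset.card_range, ← Finset.prod_mul_distrib]
        refine Finset.prod_congr rfl fun j _ => ?_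
        have h2 : a j + p + b j = ((m : ℝ) * p + 2 + j) / m := by
          simp only [ha, hb]; field_simp; ring
        have h3 : (m : ℝ) * p + 2 + j ≠ 0 := by positivity
        rw [h2]
        simp only [ha]
        field_simp
        ring
      have h4 : K * ((m : ℝ) / (m + 1)) ^ m = m + 1 := by
        rw [hK, mul_assoc, ← mul_pow]
        have : ((m : ℝ) + 1) / m * (m / (m + 1)) = 1 := by field_simp
        rw [this, one_pow, mul_one]
      calc _ = K ^ p * (∏ j ∈ Finset.range m, ∫ y, y ^ p ∂betaMeasure (a j) (b j)) * (K *
            ((∏ j ∈ Finset.range m, (a j + p) / (a j + p + b j)) *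
              ∏ j ∈ Finset.range m, ((m : ℝ) * p + 2 + j))) := by ring
        _ = _ := by rw [h1, ← mul_assoc K, h4]
    have hfact : ∀ p : ℕ, f p * (m * p + 1).factorial * p.factorial = (m * p + p).factorial := by
      intro p
      induction p with
      | zero =>
        have h1 : ∀ j, betaMeasure (a j) (b j) Set.univ = 1 := fun j =>
          (isProbabilityMeasureBeta (ha0 j) (hb0 j)).measure_univ
        simp [hf, Measure.real, h1]
      | succ p ih =>
        have h1 : ((m * (p + 1) + 1).factorial : ℝ) =
            (m * p + 1).factorial * ∏ j ∈ Finset.range m, ((m : ℝ) * p + 2 + j) := by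
          rw [show m * (p + 1) + 1 = (m * p + 1) + m by ring, ← Nat.factorial_mul_ascFactorial,
            Nat.ascFactorial_eq_prod_range]
          push_cast
          congr 1
          exact Finset.prod_congr rfl fun j _ => by ring
        have h2 : ((m * (p + 1) + (p + 1)).factorial : ℝ) =
            (m * p + p).factorial * ((∏ j ∈ Finset.range m, ((m : ℝ) * p + p + 1 + j)) *
              ((m + 1) * (p + 1))) := by
          rw [show m * (p + 1) + (p + 1) = (m * p + p) + (m + 1) by ring,
            ← Nat.factorial_mul_ascFactorial, Nat.ascFactorial_eq_prod_range,
            Finset.prod_range_succ]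
          push_cast
          congr 2
          ring
        rw [h1, h2, Nat.factorial_succ p, ← ih]
        push_cast
        calc _ = f (p + 1) * (∏ j ∈ Finset.range m, ((m : ℝ) * p + 2 + j)) *
              ((m * p + 1).factorial * ((p + 1) * p.factorial)) := by ring
          _ = _ := by rw [hrec]; ring
    have h5 := fussCatalan_factorial m p
    rw [← hfact p] at h5
    have h6 : ((m * p + 1).factorial : ℝ) ≠ 0 := by exact_mod_cast (Nat.factorial_pos _).ne'
    have h7 : (p.factorial : ℝ) ≠ 0 := by exact_mod_cast (Nat.factorial_pos _).ne'
    exact (mul_right_cancel₀ h6 (mul_right_cancel₀ h7 h5)).symm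
  · obtain ⟨n, rfl⟩ := Nat.exists_eq_add_of_le' hm
    exact prodBeta_singleton hK0 ha0 hb0 n t

/-! ### Polynomial sandwiches and determinacy of the moment problem. -/

section Sandwich
open Polynomial

theorem integrable_eval {μ : Measure ℝ} (h : ∀ p : ℕ, Integrable (fun s : ℝ => s ^ p) μ)
    (P : ℝ[X]) : Integrable (fun s => P.eval s) μ := by
  simp only [eval_eq_sum_range]
  exact integrable_finsetSum _ fun i _ => (h i).const_mul _

theorem integral_eval {μ : Measure ℝ} (h : ∀ p : ℕ, Integrable (fun s : ℝ => s ^ p) μ)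
    (P : ℝ[X]) :
    ∫ s, P.eval s ∂μ = ∑ i ∈ Finset.range (P.natDegree + 1), P.coeff i * ∫ s, s ^ i ∂μ := by
  simp only [eval_eq_sum_range]
  rw [integral_finsetSum _ fun i _ => (h i).const_mul _]
  simp only [integral_const_mul]

/-- Growth of a polynomial outside of an interval. -/
theorem abs_eval_le (P : ℝ[X]) {L : ℝ} (hL : 0 < L) {n : ℕ} (hn : P.natDegree ≤ n) {s : ℝ}
    (hs : L ≤ |s|) :
    |P.eval s| ≤ (∑ i ∈ Finset.range (P.natDegree + 1), |P.coeff i| * L ^ i) * (|s| / L) ^ n := by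
  rw [eval_eq_sum_range, Finset.sum_mul]
  refine (Finset.abs_sum_le_sum_abs _ _).trans (Finset.sum_le_sum fun i hi => ?_)
  rw [abs_mul, abs_pow, mul_assoc]
  refine mul_le_mul_of_nonneg_left ?_ (abs_nonneg _)
  have h1 : 1 ≤ |s| / L := (one_le_div hL).mpr hs
  have h2 : i ≤ n := by
    have := Finset.mem_range.mp hi
    omega
  calc |s| ^ i = L ^ i * (|s| / L) ^ i := by rw [← mul_pow, mul_div_cancel₀ _ hL.ne']
    _ ≤ _ := mul_le_mul_of_nonneg_left (pow_le_pow_right₀ h1 h2) (by positivity)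

/-- A bounded continuous function has polynomial majorants on the whole line that are close to it
in mean for a given compactly supported measure. -/
theorem exists_polynomial_ge {μ : Measure ℝ} [IsProbabilityMeasure μ] {K : ℝ} (hK : 0 < K)
    (hμ : ∀ᵐ s ∂μ, |s| ≤ K) {f : ℝ → ℝ} (hf : Continuous f) (hf1 : ∀ s, |f s| ≤ 1) {ε : ℝ}
    (hε : 0 < ε) :
    ∃ P : ℝ[X], (∀ s, f s ≤ P.eval s) ∧ ∫ s, P.eval s ∂μ ≤ ∫ s, f s ∂μ + ε := by
  set L := K + 1 with hL
  have hL0 : 0 < L := by positivity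
  obtain ⟨p, hp⟩ := exists_polynomial_near_of_continuousOn (-L) L f hf.continuousOn (ε / 4)
    (by positivity)
  -- The shift makes the approximation a majorant on `[-L, L]`.
  set p₁ : ℝ[X] := p + C (ε / 4) with hp₁
  set A := ∑ i ∈ Finset.range (p₁.natDegree + 1), |p₁.coeff i| * L ^ i with hA
  have hA0 : 0 ≤ A := Finset.sum_nonneg fun i _ => by positivity
  have hlim : Tendsto (fun q : ℕ => (A + 1) * (K / L) ^ q) atTop (𝓝 0) := by
    have h1 : K / L < 1 := by rw [div_lt_one hL0]; linarith
    have := (tendsto_pow_atTop_nhds_zero_of_lt_one (by positivity) h1).const_mul (A + 1)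
    simpa using this
  obtain ⟨n, hn1, hn2⟩ := ((hlim.eventually_lt_const (show (0 : ℝ) < ε / 4 by positivity)).and
    (eventually_ge_atTop p₁.natDegree)).exists
  have hn : (A + 1) * (K / L) ^ (2 * n) ≤ ε / 4 := by
    refine le_trans (mul_le_mul_of_nonneg_left ?_ (by positivity)) hn1.le
    refine pow_le_pow_of_le_one (by positivity) ?_ (by omega)
    rw [div_le_one hL0]; linarith
  -- The added even power is at most `ε / 4` on `[-K, K]`, since `K < L`. Beyond `L` its multiple by
  -- `A` compensates for `p₁`, and the extra 1 pays for `f ≤ 1`.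
  set P : ℝ[X] := p₁ + C (A + 1) * (C L⁻¹ * X) ^ (2 * n) with hP
  have heval : ∀ s, P.eval s = p₁.eval s + (A + 1) * (|s| / L) ^ (2 * n) := by
    intro s
    have : (L⁻¹ * s) ^ (2 * n) = (|s| / L) ^ (2 * n) := by
      rw [pow_mul, pow_mul, div_pow, sq_abs, mul_pow, inv_pow, inv_mul_eq_div]
    simp [hP, this]
  have hin : ∀ s, |s| ≤ L → f s ≤ p₁.eval s ∧ p₁.eval s ≤ f s + ε / 2 := by
    intro s hs
    have h1 := abs_lt.mp (hp s (abs_le.mp hs))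
    simp only [hp₁, eval_add, eval_C]
    constructor <;> linarith [h1.1, h1.2]
  refine ⟨P, fun s => ?_, ?_⟩
  · rw [heval]
    rcases le_total |s| L with hs | hs
    · have := (hin s hs).1
      have : 0 ≤ (A + 1) * (|s| / L) ^ (2 * n) := by positivity
      linarith
    · have h1 := abs_eval_le p₁ hL0 (show p₁.natDegree ≤ 2 * n by omega) hs
      rw [← hA] at h1
      have h2 : 1 ≤ (|s| / L) ^ (2 * n) := one_le_pow₀ ((one_le_div hL0).mpr hs)
      have h3 := (abs_le.mp h1).1
      have h4 := (abs_le.mp (hf1 s)).2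
      linarith
  · have hfi : Integrable f μ := Integrable.of_bound hf.aestronglyMeasurable 1
      (ae_of_all _ fun s => by simpa using hf1 s)
    have hpow : ∀ i : ℕ, Integrable (fun s : ℝ => s ^ i) μ := by
      intro i
      refine Integrable.of_bound (by fun_prop) (K ^ i) ?_
      filter_upwards [hμ] with s hs
      rw [norm_pow, Real.norm_eq_abs]
      exact pow_le_pow_left₀ (abs_nonneg s) hs i
    calc ∫ s, P.eval s ∂μ ≤ ∫ s, (f s + ε) ∂μ := by
          refine integral_mono_ae (integrable_eval hpow P) (hfi.add (integrable_const ε)) ?_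
          filter_upwards [hμ] with s hs
          rw [heval]
          have h1 := (hin s (by linarith)).2
          have h2 : (A + 1) * (|s| / L) ^ (2 * n) ≤ (A + 1) * (K / L) ^ (2 * n) := by gcongr
          linarith
      _ = _ := by
          rw [integral_add hfi (integrable_const ε)]
          simp

/-- A continuous ramp that is one on the left of `t` and zero on the right of `t + 1 / n`. -/
noncomputable def ramp (n : ℕ) (t s : ℝ) : ℝ := max 0 (min 1 (1 - n * (s - t)))

theorem continuous_ramp (n : ℕ) (t : ℝ) : Continuous (ramp n t) := by
  unfold ramp; fun_prop

theorem ramp_nonneg (n : ℕ) (t s : ℝ) : 0 ≤ ramp n t s := le_max_left _ _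

theorem ramp_le_one (n : ℕ) (t s : ℝ) : ramp n t s ≤ 1 :=
  max_le zero_le_one (min_le_left _ _)

theorem ramp_of_le {n : ℕ} {t s : ℝ} (h : s ≤ t) : ramp n t s = 1 := by
  have : 0 ≤ (n : ℝ) * (t - s) := mul_nonneg (Nat.cast_nonneg n) (by linarith)
  rw [ramp, min_eq_left (by linarith), max_eq_right zero_le_one]

theorem tendsto_ramp (t s : ℝ) :
    Tendsto (fun n => ramp n t s) atTop (𝓝 (Set.indicator (Set.Iic t) (fun _ => (1 : ℝ)) s)) := by
  by_cases h : s ≤ t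
  · rw [Set.indicator_of_mem (show s ∈ Set.Iic t from h)]
    exact tendsto_const_nhds.congr fun n => (ramp_of_le h).symm
  · rw [Set.indicator_of_notMem (show s ∉ Set.Iic t from h)]
    push Not at h
    refine tendsto_const_nhds.congr' ?_
    have h1 : Tendsto (fun n : ℕ => (n : ℝ) * (s - t)) atTop atTop :=
      tendsto_natCast_atTop_atTop.atTop_mul_const (by linarith)
    filter_upwards [h1.eventually_ge_atTop 1] with n hn
    rw [ramp, max_eq_left]
    exact (min_le_right _ _).trans (by linarith)

/-- Polynomial approximation, in mean and from both sides, of the indicator of a half-line. -/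
theorem exists_polynomial_sandwich {μ : Measure ℝ} [IsProbabilityMeasure μ] {K : ℝ} (hK : 0 < K)
    (hμ : ∀ᵐ s ∂μ, |s| ≤ K) {t : ℝ} (ht : μ {t} = 0) {ε : ℝ} (hε : 0 < ε) :
    ∃ P Q : ℝ[X], (∀ s, Set.indicator (Set.Iic t) (fun _ => (1 : ℝ)) s ≤ P.eval s) ∧
      (∀ s, Q.eval s ≤ Set.indicator (Set.Iic t) (fun _ => (1 : ℝ)) s) ∧
      ∫ s, P.eval s ∂μ ≤ cdf μ t + ε ∧ cdf μ t - ε ≤ ∫ s, Q.eval s ∂μ := by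
  have hcdf : ∫ s, Set.indicator (Set.Iic t) (fun _ => (1 : ℝ)) s ∂μ = cdf μ t := by
    rw [cdf_eq_real, integral_indicator_const _ measurableSet_Iic]
    simp
  have hbound : ∀ n s, ‖ramp n t s‖ ≤ 1 := fun n s => by
    rw [Real.norm_of_nonneg (ramp_nonneg n t s)]; exact ramp_le_one n t s
  have hup : Tendsto (fun n => ∫ s, ramp n t s ∂μ) atTop (𝓝 (cdf μ t)) := by
    rw [← hcdf]
    exact tendsto_integral_of_dominated_convergence (fun _ => 1)
      (fun n => (continuous_ramp n t).aestronglyMeasurable) (integrable_const 1)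
      (fun n => ae_of_all _ (hbound n)) (ae_of_all _ (tendsto_ramp t))
  -- The reflected ramp approximates the indicator of `s < t` from below. The discrepancy at `t` is
  -- null because there is no atom.
  have hlow : Tendsto (fun n => ∫ s, (1 - ramp n (-t) (-s)) ∂μ) atTop (𝓝 (cdf μ t)) := by
    rw [← hcdf]
    refine tendsto_integral_of_dominated_convergence (fun _ => 1)
      (fun n => (continuous_const.sub
        ((continuous_ramp n (-t)).comp continuous_neg)).aestronglyMeasurable) (integrable_const 1)
      (fun n => ae_of_all _ fun s => ?_) ?_
    · rw [Real.norm_eq_abs, abs_le]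
      constructor <;> linarith [ramp_nonneg n (-t) (-s), ramp_le_one n (-t) (-s)]
    · have hne : ∀ᵐ s ∂μ, s ≠ t := by
        rw [ae_iff]; simpa using ht
      filter_upwards [hne] with s hs
      have h1 := (tendsto_ramp (-t) (-s)).const_sub 1
      convert h1 using 2
      by_cases h : s ≤ t
      · have h2 : ¬ t ≤ s := fun h2 => hs (le_antisymm h h2)
        simp [Set.indicator, h, h2]
      · simp [Set.indicator, h, (not_le.mp h).le]
  obtain ⟨n, hn⟩ := (hup.eventually_le_const (show cdf μ t < cdf μ t + ε / 2 by linarith)).exists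
  obtain ⟨k, hk⟩ := (hlow.eventually_const_le (show cdf μ t - ε / 2 < cdf μ t by linarith)).exists
  obtain ⟨P, hP1, hP2⟩ := exists_polynomial_ge hK hμ (continuous_ramp n t)
    (fun s => by simpa using hbound n s) (half_pos hε)
  obtain ⟨Q, hQ1, hQ2⟩ := exists_polynomial_ge hK hμ
    (f := fun s => -(1 - ramp k (-t) (-s)))
    (continuous_const.sub ((continuous_ramp k (-t)).comp continuous_neg)).neg
    (fun s => by
      rw [abs_le]
      constructor <;> linarith [ramp_nonneg k (-t) (-s), ramp_le_one k (-t) (-s)]) (half_pos hε)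
  refine ⟨P, -Q, fun s => ?_, fun s => ?_, by linarith, ?_⟩
  · refine le_trans ?_ (hP1 s)
    by_cases h : s ≤ t
    · rw [ramp_of_le h, Set.indicator_of_mem (show s ∈ Set.Iic t from h)]
    · rw [Set.indicator_of_notMem (show s ∉ Set.Iic t from h)]
      exact ramp_nonneg n t s
  · have h1 := hQ1 s
    rw [eval_neg]
    by_cases h : s ≤ t
    · rw [Set.indicator_of_mem (show s ∈ Set.Iic t from h)]
      linarith [ramp_nonneg k (-t) (-s)]
    · rw [Set.indicator_of_notMem (show s ∉ Set.Iic t from h)]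
      rw [ramp_of_le (by linarith [not_le.mp h])] at h1
      linarith
  · simp only [eval_neg]
    rw [integral_neg] at hQ2 ⊢
    linarith

/-- A compactly supported measure without atoms is determined by its moments. -/
theorem eq_of_moments {μ ν : Measure ℝ} [IsProbabilityMeasure μ] [IsProbabilityMeasure ν] {K : ℝ}
    (hK : 0 < K) (hμ : ∀ᵐ s ∂μ, |s| ≤ K) (hatom : ∀ t, μ {t} = 0)
    (hμp : ∀ p : ℕ, Integrable (fun s : ℝ => s ^ p) μ)
    (hνp : ∀ p : ℕ, Integrable (fun s : ℝ => s ^ p) ν)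
    (h : ∀ p : ℕ, ∫ s, s ^ p ∂ν = ∫ s, s ^ p ∂μ) : ν = μ := by
  have heval : ∀ P : ℝ[X], ∫ s, P.eval s ∂ν = ∫ s, P.eval s ∂μ := by
    intro P
    rw [integral_eval hνp, integral_eval hμp]
    simp only [h]
  have hcdf : ∀ t, cdf ν t = cdf μ t := by
    intro t
    have hind : Integrable (Set.indicator (Set.Iic t) (fun _ => (1 : ℝ))) ν :=
      (integrable_const 1).indicator measurableSet_Iic
    have hc : ∫ s, Set.indicator (Set.Iic t) (fun _ => (1 : ℝ)) s ∂ν = cdf ν t := by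
      rw [cdf_eq_real, integral_indicator_const _ measurableSet_Iic]
      simp
    refine le_antisymm (le_of_forall_pos_le_add fun ε hε => ?_)
      (le_of_forall_pos_le_add fun ε hε => ?_)
    · obtain ⟨P, Q, hP, -, hPi, -⟩ := exists_polynomial_sandwich hK hμ (hatom t) hε
      rw [← hc]
      exact (integral_mono hind (integrable_eval hνp P) hP).trans ((heval P).trans_le hPi)
    · obtain ⟨P, Q, -, hQ, -, hQi⟩ := exists_polynomial_sandwich hK hμ (hatom t) hε
      have := integral_mono (integrable_eval hνp Q) hind hQ
      rw [hc, heval] at this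
      linarith
  rw [← measure_cdf ν, ← measure_cdf μ]
  congr 1
  exact StieltjesFunction.ext hcdf

/-- Polynomials that converge pointwise to the indicator of a half-line. -/
theorem exists_polynomial_tendsto_indicator (t : ℝ) :
    ∃ p : ℕ → ℝ[X], ∀ s, Tendsto (fun n => (p n).eval s) atTop
      (𝓝 (Set.indicator (Set.Iic t) (fun _ => (1 : ℝ)) s)) := by
  choose p hp using fun n : ℕ => exists_polynomial_near_of_continuousOn (-(n : ℝ)) n (ramp n t)
    (continuous_ramp n t).continuousOn (1 / ((n : ℝ) + 1)) (by positivity)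
  refine ⟨p, fun s => (tendsto_ramp t s).congr_dist ?_⟩
  refine squeeze_zero' (Eventually.of_forall fun _ => dist_nonneg) ?_
    tendsto_one_div_add_atTop_nhds_zero_nat
  filter_upwards [tendsto_natCast_atTop_atTop.eventually_ge_atTop |s|] with n hn
  rw [dist_comm, Real.dist_eq]
  exact (hp n s (abs_le.mp hn)).le

end Sandwich

/-! ### The empirical distribution function: measurability, stability, convergence. -/

theorem trace_pow_eq_sum_eigenvalues {N : ℕ} {A : Matrix (Fin N) (Fin N) ℂ} (hA : A.IsHermitian)
    (p : ℕ) : (A ^ p).trace = ∑ k, ((hA.eigenvalues k : ℝ) : ℂ) ^ p := by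
  have h := hA.spectral_theorem
  conv_lhs => rw [h, ← map_pow, Unitary.conjStarAlgAut_apply, Matrix.trace_mul_comm, ← mul_assoc]
  simp [Matrix.diagonal_pow, Matrix.trace_diagonal]

theorem continuous_trace_powerGram_pow (N m p : ℕ) :
    Continuous fun X : Fin N → Fin N → ℂ => (powerGram m (Matrix.of X) ^ p).trace := by
  unfold powerGram
  fun_prop

/-- The mean of a polynomial over the eigenvalues of `X^m (X^*)^m`. -/
noncomputable def empiricalMean {N : ℕ} (m : ℕ) (X : Matrix (Fin N) (Fin N) ℂ) (Q : Polynomial ℝ) : ℝ :=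
  (N : ℝ)⁻¹ * ∑ k : Fin N, Q.eval ((powerGram_isHermitian m X).eigenvalues k)

theorem empiricalMean_eq {N : ℕ} (m : ℕ) (X : Matrix (Fin N) (Fin N) ℂ) (Q : Polynomial ℝ) :
    empiricalMean m X Q = ∑ i ∈ Finset.range (Q.natDegree + 1),
      Q.coeff i * ((N : ℂ)⁻¹ * (powerGram m X ^ i).trace).re := by
  have h1 : ∀ i, ((N : ℂ)⁻¹ * (powerGram m X ^ i).trace).re =
      (N : ℝ)⁻¹ * ∑ k, ((powerGram_isHermitian m X).eigenvalues k) ^ i := by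
    intro i
    rw [trace_pow_eq_sum_eigenvalues (powerGram_isHermitian m X)]
    have h2 : (N : ℂ)⁻¹ * ∑ k, (((powerGram_isHermitian m X).eigenvalues k : ℝ) : ℂ) ^ i =
        (((N : ℝ)⁻¹ * ∑ k, ((powerGram_isHermitian m X).eigenvalues k) ^ i : ℝ) : ℂ) := by
      push_cast; rfl
    rw [h2, Complex.ofReal_re]
  simp only [empiricalMean, h1, Polynomial.eval_eq_sum_range]
  rw [Finset.sum_comm, Finset.mul_sum]
  refine Finset.sum_congr rfl fun i _ => ?_
  rw [← Finset.mul_sum]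
  ring

theorem continuous_empiricalMean (N m : ℕ) (Q : Polynomial ℝ) :
    Continuous fun X : Fin N → Fin N → ℂ => empiricalMean m (Matrix.of X) Q := by
  simp only [empiricalMean_eq]
  refine continuous_finsetSum _ fun i _ => continuous_const.mul ?_
  exact Complex.continuous_re.comp (continuous_const.mul (continuous_trace_powerGram_pow N m i))

/-- Measurability of individual eigenvalues is bypassed: polynomial means over the spectrum are
continuous in `X` through traces, and they converge pointwise to the distribution function. -/
theorem measurable_empiricalDF (N m : ℕ) (t : ℝ) :
    Measurable fun X : Fin N → Fin N → ℂ => empiricalDF m (Matrix.of X) t := by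
  obtain ⟨p, hp⟩ := exists_polynomial_tendsto_indicator t
  refine measurable_of_tendsto_metrizable (f := fun n X => empiricalMean m (Matrix.of X) (p n))
    (fun n => (continuous_empiricalMean N m (p n)).measurable) ?_
  rw [tendsto_pi_nhds]
  intro X
  simp only [empiricalMean, empiricalDF]
  exact (tendsto_finsetSum _ fun k _ => hp _).const_mul _

theorem empiricalDF_nonneg {N : ℕ} (m : ℕ) (X : Matrix (Fin N) (Fin N) ℂ) (t : ℝ) :
    0 ≤ empiricalDF m X t :=
  mul_nonneg (by positivity)
    (Finset.sum_nonneg fun _ _ => Set.indicator_nonneg (fun _ _ => zero_le_one) _)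

theorem empiricalDF_le_one {N : ℕ} (m : ℕ) (X : Matrix (Fin N) (Fin N) ℂ) (t : ℝ) :
    empiricalDF m X t ≤ 1 := by
  rw [empiricalDF]
  have h1 : ∑ k : Fin N, Set.indicator (Set.Iic t) (fun _ => (1 : ℝ))
      ((powerGram_isHermitian m X).eigenvalues k) ≤ N := by
    refine (Finset.sum_le_sum fun k _ =>
      Set.indicator_le_self' (fun _ _ => zero_le_one) _).trans_eq ?_
    simp
  exact (mul_le_mul_of_nonneg_left h1 (by positivity)).trans inv_mul_le_one

section
variable {Ω : Type*} [MeasurableSpace Ω] {P : Measure Ω}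

theorem integral_empiricalMean {N m : ℕ} {X : Fin N → Fin N → Ω → ℂ}
    (hint : ∀ i : ℕ, Integrable
      (fun ω => (powerGram m (Matrix.of fun i j => X i j ω) ^ i).trace) P) (Q : Polynomial ℝ) :
    Integrable (fun ω => empiricalMean m (Matrix.of fun i j => X i j ω) Q) P ∧
    ∫ ω, empiricalMean m (Matrix.of fun i j => X i j ω) Q ∂P =
      ∑ i ∈ Finset.range (Q.natDegree + 1), Q.coeff i *
        ((N : ℂ)⁻¹ * ∫ ω, (powerGram m (Matrix.of fun i j => X i j ω) ^ i).trace ∂P).re := by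
  have h1 : ∀ i : ℕ, Integrable (fun ω => Q.coeff i *
      ((N : ℂ)⁻¹ * (powerGram m (Matrix.of fun i j => X i j ω) ^ i).trace).re) P :=
    fun i => (((hint i).const_mul _).re).const_mul _
  simp only [empiricalMean_eq]
  refine ⟨integrable_finsetSum _ fun i _ => h1 i, ?_⟩
  rw [integral_finsetSum _ fun i _ => h1 i]
  refine Finset.sum_congr rfl fun i _ => ?_
  rw [integral_const_mul, ← integral_const_mul ((N : ℂ)⁻¹)]
  congr 1
  exact integral_re ((hint i).const_mul ((N : ℂ)⁻¹))

variable [IsProbabilityMeasure P]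

theorem integrable_empiricalDF {N : ℕ} (m : ℕ) (t : ℝ) {X : Fin N → Fin N → Ω → ℂ}
    (hX : ∀ i j, AEMeasurable (X i j) P) :
    Integrable (fun ω => empiricalDF m (Matrix.of fun i j => X i j ω) t) P := by
  have h1 : AEMeasurable (fun ω i j => X i j ω) P :=
    aemeasurable_pi_lambda _ fun i => aemeasurable_pi_lambda _ fun j => hX i j
  refine Integrable.of_bound
    ((measurable_empiricalDF N m t).comp_aemeasurable h1).aestronglyMeasurable 1
    (ae_of_all _ fun ω => ?_)
  rw [Real.norm_of_nonneg (empiricalDF_nonneg m _ t)]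
  exact empiricalDF_le_one m _ t

/-- Two matrix models that agree up to an event have mean distribution functions that differ by at
most the probability of the event. -/
theorem abs_integral_empiricalDF_sub_le {N : ℕ} (m : ℕ) (t : ℝ) {X Y : Fin N → Fin N → Ω → ℂ}
    (hX : ∀ i j, AEMeasurable (X i j) P) (hY : ∀ i j, AEMeasurable (Y i j) P)
    (A : Fin N × Fin N → Set Ω) (hA : ∀ e, NullMeasurableSet (A e) P)
    (h : ∀ i j ω, ω ∉ A (i, j) → X i j ω = Y i j ω) :
    |∫ ω, empiricalDF m (Matrix.of fun i j => X i j ω) t ∂P -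
      ∫ ω, empiricalDF m (Matrix.of fun i j => Y i j ω) t ∂P| ≤ ∑ e, P.real (A e) := by
  rw [← integral_sub (integrable_empiricalDF m t hX) (integrable_empiricalDF m t hY),
    ← Real.norm_eq_abs]
  have h1 : ∑ e, P.real (A e) = ∫ ω, ∑ e, Set.indicator (A e) (fun _ => (1 : ℝ)) ω ∂P := by
    rw [integral_finsetSum _ fun e _ => (integrable_const 1).indicator₀ (hA e)]
    refine Finset.sum_congr rfl fun e _ => ?_
    rw [integral_indicator₀ (hA e), setIntegral_const, smul_eq_mul, mul_one]
  rw [h1]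
  refine norm_integral_le_of_norm_le
    (integrable_finsetSum _ fun e _ => (integrable_const 1).indicator₀ (hA e))
    (ae_of_all _ fun ω => ?_)
  have hnn : ∀ e, 0 ≤ Set.indicator (A e) (fun _ => (1 : ℝ)) ω :=
    fun e => Set.indicator_nonneg (fun _ _ => zero_le_one) _
  by_cases hω : ∃ e, ω ∈ A e
  · obtain ⟨e, he⟩ := hω
    have h2 : (1 : ℝ) ≤ ∑ e, Set.indicator (A e) (fun _ => (1 : ℝ)) ω := by
      refine le_trans (le_of_eq ?_)
        (Finset.single_le_sum (fun e _ => hnn e) (Finset.mem_univ e))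
      rw [Set.indicator_of_mem he]
    refine le_trans ?_ h2
    rw [Real.norm_eq_abs, abs_le]
    constructor <;>
    linarith [empiricalDF_nonneg m (Matrix.of fun i j => X i j ω) t,
      empiricalDF_nonneg m (Matrix.of fun i j => Y i j ω) t,
      empiricalDF_le_one m (Matrix.of fun i j => X i j ω) t,
      empiricalDF_le_one m (Matrix.of fun i j => Y i j ω) t]
  · push Not at hω
    have h2 : (fun i j => X i j ω) = fun i j => Y i j ω := by
      ext i j : 2
      exact h i j ω (hω _)
    rw [h2, sub_self, norm_zero]
    exact Finset.sum_nonneg fun e _ => hnn e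

/-- Convergence of the mean spectral moments implies that of the mean distribution functions. -/
theorem tendsto_integral_empiricalDF {m : ℕ} {X : (N : ℕ) → Fin N → Fin N → Ω → ℂ}
    (hX : ∀ N i j, AEMeasurable (X N i j) P)
    (hint : ∀ N i : ℕ, Integrable
      (fun ω => (powerGram m (Matrix.of fun i j => X N i j ω) ^ i).trace) P)
    {G : Measure ℝ} [IsProbabilityMeasure G] {K : ℝ} (hK : 0 < K) (hG : ∀ᵐ s ∂G, |s| ≤ K)
    (hGp : ∀ p : ℕ, Integrable (fun s : ℝ => s ^ p) G)
    (hlim : ∀ p : ℕ, Tendsto (fun N : ℕ => (N : ℂ)⁻¹ *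
      ∫ ω, (powerGram m (Matrix.of fun i j => X N i j ω) ^ p).trace ∂P) atTop
      (𝓝 ((∫ s, s ^ p ∂G : ℝ) : ℂ))) {t : ℝ} (ht : G {t} = 0) :
    Tendsto (fun N : ℕ => ∫ ω, empiricalDF m (Matrix.of fun i j => X N i j ω) t ∂P) atTop
      (𝓝 (cdf G t)) := by
  have hmean : ∀ Q : Polynomial ℝ, Tendsto (fun N : ℕ =>
      ∫ ω, empiricalMean m (Matrix.of fun i j => X N i j ω) Q ∂P) atTop
      (𝓝 (∫ s, Q.eval s ∂G)) := by
    intro Q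
    simp only [fun N => (integral_empiricalMean (hint N) Q).2]
    rw [integral_eval hGp]
    refine tendsto_finsetSum _ fun i _ => Tendsto.const_mul _ ?_
    have := (Complex.continuous_re.tendsto _).comp (hlim i)
    rwa [Complex.ofReal_re] at this
  rw [Metric.tendsto_atTop']
  intro ε hε
  -- The inequalities must hold on the whole line, since the eigenvalues need not lie in the support
  -- of `G`.
  obtain ⟨Q, R, hQ, hR, hQi, hRi⟩ := exists_polynomial_sandwich hK hG ht (half_pos hε)
  have hev := ((hmean Q).eventually_lt_const
    (show ∫ s, Q.eval s ∂G < cdf G t + ε by linarith)).and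
    ((hmean R).eventually_const_lt (show cdf G t - ε < ∫ s, R.eval s ∂G by linarith))
  obtain ⟨N₀, hN₀⟩ := eventually_atTop.mp hev
  refine ⟨N₀, fun N hN => ?_⟩
  obtain ⟨h1, h2⟩ := hN₀ N hN.le
  have hF := integrable_empiricalDF m t (hX N)
  have h3 : ∫ ω, empiricalDF m (Matrix.of fun i j => X N i j ω) t ∂P ≤
      ∫ ω, empiricalMean m (Matrix.of fun i j => X N i j ω) Q ∂P := by
    refine integral_mono hF (integral_empiricalMean (hint N) Q).1 fun ω => ?_
    exact mul_le_mul_of_nonneg_left (Finset.sum_le_sum fun k _ => hQ _) (by positivity)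
  have h4 : ∫ ω, empiricalMean m (Matrix.of fun i j => X N i j ω) R ∂P ≤
      ∫ ω, empiricalDF m (Matrix.of fun i j => X N i j ω) t ∂P := by
    refine integral_mono (integral_empiricalMean (hint N) R).1 hF fun ω => ?_
    exact mul_le_mul_of_nonneg_left (Finset.sum_le_sum fun k _ => hR _) (by positivity)
  rw [Real.dist_eq, abs_lt]
  constructor <;> linarith

end

/-! ### Conclusion: removal of the truncation. -/

theorem corollary1 {Ω₀ Ω : Type*} [MeasurableSpace Ω₀] [MeasurableSpace Ω]
    (P₀ : Measure Ω₀) [IsProbabilityMeasure P₀] (P : Measure Ω) [IsProbabilityMeasure P]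
    (m : ℕ) (hm : 1 ≤ m)
    (x : Ω₀ → ℂ) (hx : AEMeasurable x P₀)
    (hx_mean : ∫ ω, x ω ∂P₀ = 0)
    (hx_var : ∫ ω, ‖x ω‖ ^ 2 ∂P₀ = 1)
    (hx_four : Integrable (fun ω => ‖x ω‖ ^ 4) P₀)
    (xs : (N : ℕ) → Fin N → Fin N → Ω → ℂ)
    (h_copies : ∀ (N : ℕ) (i j : Fin N), IdentDistrib (xs N i j) x P P₀)
    (h_indep : ∀ N : ℕ, iIndepFun (fun ij : Fin N × Fin N => xs N ij.1 ij.2) P) :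
    ∃ G : Measure ℝ, IsFussCatalanLaw m G ∧
      (∀ ν : Measure ℝ, IsFussCatalanLaw m ν → ν = G) ∧
      ∀ t : ℝ,
        (∀ N : ℕ,
          Integrable (fun ω => empiricalDF m (scaledMatrix fun i j => xs N i j ω) t) P) ∧
        Tendsto
          (fun N : ℕ => ∫ ω, empiricalDF m (scaledMatrix fun i j => xs N i j ω) t ∂P)
          atTop (𝓝 (cdf G t)) := by
  obtain ⟨G, K, hK, hG, hGK, hatom⟩ := exists_isFussCatalanLaw hm
  have hGprob := hG.isProbabilityMeasure
  have hae : ∀ N i j, AEMeasurable (xs N i j) P := fun N i j => (h_copies N i j).aemeasurable_fst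
  have hae' : ∀ (N : ℕ) (i j : Fin N), AEMeasurable (fun ω => ((Real.sqrt N : ℝ) : ℂ)⁻¹ * xs N i j ω) P :=
    fun N i j => (hae N i j).const_mul _
  refine ⟨G, hG, fun ν hν => ?_, fun t => ⟨fun N => integrable_empiricalDF m t (hae' N), ?_⟩⟩
  · have := hν.isProbabilityMeasure
    exact eq_of_moments hK hGK hatom hG.integrable_pow hν.integrable_pow
      fun p => (hν.moment_eq p).trans (hG.moment_eq p).symm
  -- The moment method is applied to the truncated matrix: with only four moments of `x`, the
  -- spectral moments of the original matrix need not be integrable.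
  obtain ⟨g, C, η, r, hg, hC, hη, h0, h1, h2, h11, hgr, hr⟩ :=
    exists_truncation hx hx_mean hx_var hx_four
  have hlim := fun p => tendsto_trace_powerGram h_copies h_indep hg hC hη h0 h1 h2 h11 hm p
  have hY : ∀ N i j, AEMeasurable (fun ω => g N (xs N i j ω)) P :=
    fun N i j => (hg N).comp_aemeasurable (hae N i j)
  have hint : ∀ N p : ℕ, Integrable
      (fun ω => (powerGram m (Matrix.of fun i j => g N (xs N i j ω)) ^ p).trace) P := by
    intro N p
    simp only [← wordProd_zigzag]
    exact integrable_trace_wordProd (X := fun e : Fin N × Fin N => xs N e.1 e.2)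
      (fun e => hae N e.1 e.2) (hg N) (hC N) _
  have htrunc := tendsto_integral_empiricalDF hY hint hK hGK hG.integrable_pow
    (fun p => by rw [hG.moment_eq p]; exact hlim p) (hatom t)
  -- The two models differ only if some entry exceeds `r N`. The union bound over `N²` entries is
  -- the quantity that tends to zero in `hr`.
  refine htrunc.congr_dist (squeeze_zero (fun _ => dist_nonneg) (fun N => ?_) hr)
  rw [dist_comm, Real.dist_eq]
  refine (abs_integral_empiricalDF_sub_le m t (hae' N) (hY N)
    (fun e => {ω | r N < ‖xs N e.1 e.2 ω‖}) (fun e => ?_) (fun i j ω hω => ?_)).trans_eq ?_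
  · exact (hae N e.1 e.2).nullMeasurable (measurableSet_lt measurable_const measurable_norm)
  · exact (hgr N _ (not_lt.mp hω)).symm
  · have h3 : ∀ e : Fin N × Fin N, P.real {ω | r N < ‖xs N e.1 e.2 ω‖} =
        P₀.real {ω | r N < ‖x ω‖} := by
      intro e
      exact congrArg ENNReal.toReal ((h_copies N e.1 e.2).measure_mem_eq
        (s := {z : ℂ | r N < ‖z‖}) (measurableSet_lt measurable_const measurable_norm))
    simp only [h3, Finset.sum_const, Finset.card_univ, Fintype.card_prod, Fintype.card_fin,
      nsmul_eq_mul]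
    push_cast
    ring
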